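/- **A posteriori error identity for the Stinga–Torrea extended problem.** Let $d\ge 1$, let $\Omega\subset\mathbb R^d$ be a bounded open set (for instance a bounded Lipschitz domain), $0<s<1$, $Q:=\Omega\times(0,\infty)$ with points $(x,t)$, and $\Gamma:=\partial\Omega\times(0,\infty)$. Write $\nabla_{xt}w=(\nabla_xw,w_t)$, let $\operatorname{div}_{xt}$ be the corresponding divergence in $\mathbb R^{d+1}$ (both understood weakly), let $\odot$ be the scalar product of $\mathbb R^{d+1}$, and put $$\|\mathbf y\|_t^2:=\int_Q t^{1-2s}|\mathbf y|^2\,dx\,dt .$$ Let $\mathcal V$ be the closure of the smooth functions with bounded support vanishing on $\Gamma$ with respect to the norm $\|\nabla_{xt}w\|_t$. Each $w\in\mathcal V$ has a trace $w(\cdot,0)\in L^2(\Omega)$; let $T$ be the space of these traces with the norm $\|v\|_T=\inf\{\|\nabla_{xt}w\|_t:\ w\in\mathcal V,\ w(\cdot,0)=v\}$ and $T^*$ its dual. For $G\in T^*$ and $v\in T$ we write $\int_\Omega G\,v\,dx$ for the duality pairing; it is the usual integral if $G$ is given by a function on $\Omega$. Let $g\in T^*$ and let $w\in\mathcal V$ be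 the weak solution of $$w_{tt}+\tfrac{1-2s}{t}w_t+\Delta_xw=0\ \text{ in }Q,\qquad -\lim_{t\to0+}t^{1-2s}w_t=g\ \text{ in }\Omega,\qquad w=0\ \text{ on }\Gamma,$$ that is, $$\int_Q t^{1-2s}\,\nabla_{xt}w\odot\nabla_{xt}\eta\,dx\,dt-\int_\Omega g\,\eta(x,0)\,dx=0\qquad\text{for all }\eta\in\mathcal V,$$ and let $\mathbf p:=t^{1-2s}\nabla_{xt}w$ be its flux. Let $Y_{\rm div}$ be the set of vector fields $\mathbf y:Q\to\mathbb R^{d+1}$ with $$\|t^{2s-1}\mathbf y\|_t^2=\int_Q t^{2s-1}|\mathbf y|^2\,dx\,dt<\infty,\qquad \int_Q t^{2s-1}|\operatorname{div}_{xt}\mathbf y|^2\,dx\,dt<\infty .$$ Every $\mathbf y\in Y_{\rm div}$ has a unique boundary value $y_{d+1}(\cdot,0)\in T^*$ for which $$\int_Q(\mathbf y\odot\nabla_{xt}\varphi+\varphi\operatorname{div}_{xt}\mathbf y)\,dx\,dt=-\int_\Omega y_{d+1}(x,0)\,\varphi(x,0)\,dx\qquad\text{for all }\varphi\in C_c^\infty(\Omega\times\mathbb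 R).$$ Then for every $\widetilde w\in\mathcal V$ and every $\mathbf y\in Y_{\rm div}$, with $e_w:=\widetilde w-w$ and $\mathbf e_{\mathbf p}:=\mathbf y-\mathbf p$, all terms below are well defined and finite, and $$\|\nabla_{xt}e_w\|_t^2+\|t^{2s-1}\mathbf e_{\mathbf p}\|_t^2=\|\nabla_{xt}\widetilde w-t^{2s-1}\mathbf y\|_t^2-2\int_Q e_w\,\operatorname{div}_{xt}\mathbf y\,dx\,dt-2\int_\Omega e_w(x,0)\,\bigl(g+y_{d+1}(x,0)\bigr)\,dx .$$ -/

import Mathlib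

open MeasureTheory Set Filter Topology
open scoped ContDiff ENNReal RealInnerProductSpace

namespace StingaTorrea

/-- The space `ℝᵈ` of the variable `x`. -/
abbrev E (d : ℕ) := EuclideanSpace ℝ (Fin d)

/-- Values of `(d+1)`-dimensional vector fields `𝐲 = (y₁, …, y_d, y_{d+1})`, with the Euclidean
inner product. -/
abbrev Vec (d : ℕ) := WithLp 2 (E d × ℝ)

/-- The half-cylinder `Q = Ω × (0, ∞)`; its points are pairs `(x, t)`. -/
def halfCyl {d : ℕ} (Ω : Set (E d)) : Set (E d × ℝ) := Ω ×ˢ Ioi (0 : ℝ)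

/-- The measure `t ^ a dx dt` on the half-cylinder `Q`. -/
noncomputable def wMeas {d : ℕ} (Ω : Set (E d)) (a : ℝ) : Measure (E d × ℝ) :=
  (volume.restrict (halfCyl Ω)).withDensity (fun z => ENNReal.ofReal (z.2 ^ a))

/-- The classical gradient `∇_{xt} φ = (∇_x φ, φ_t)` of a smooth function. -/
noncomputable def gradXT {d : ℕ} (φ : E d × ℝ → ℝ) (z : E d × ℝ) : Vec d :=
  WithLp.toLp 2 (gradient (fun x => φ (x, z.2)) z.1, deriv (fun t => φ (z.1, t)) z.2)

/-- Smooth functions with bounded support that vanish on `Γ = ∂Ω × (0, ∞)`. -/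
def IsTest {d : ℕ} (Ω : Set (E d)) (φ : E d × ℝ → ℝ) : Prop :=
  ContDiff ℝ ∞ φ ∧ HasCompactSupport φ ∧ ∀ x ∈ frontier Ω, ∀ t : ℝ, 0 < t → φ (x, t) = 0

/-- Smooth functions with compact support contained in the set `U`. -/
def IsCc {d : ℕ} (U : Set (E d × ℝ)) (ψ : E d × ℝ → ℝ) : Prop :=
  ContDiff ℝ ∞ ψ ∧ HasCompactSupport ψ ∧ tsupport ψ ⊆ U

/-- `φ n` is a sequence of smooth functions with bounded support vanishing on `Γ`, it is a Cauchy
sequence in the norm `(∫_Q t^{1-2s} |∇_{xt} φ|²)^{1/2}`, and its limit is the function `w`. -/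
def Approx {d : ℕ} (Ω : Set (E d)) (s : ℝ) (φ : ℕ → E d × ℝ → ℝ) (w : E d × ℝ → ℝ) : Prop :=
  (∀ n, IsTest Ω (φ n)) ∧
  (∀ ε : ℝ≥0∞, 0 < ε → ∃ N : ℕ, ∀ m, N ≤ m → ∀ n, N ≤ n →
    eLpNorm (gradXT (φ m) - gradXT (φ n)) 2 (wMeas Ω (1 - 2 * s)) ≤ ε) ∧
  Tendsto (fun n => eLpNorm (φ n - w) 2 (wMeas Ω (1 - 2 * s))) atTop (𝓝 0)

/-- The energy space `𝓥`: the closure of the smooth functions with bounded support vanishing on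
`Γ` with respect to the norm `(∫_Q t^{1-2s} |∇_{xt} w|²)^{1/2}`. -/
def MemV {d : ℕ} (Ω : Set (E d)) (s : ℝ) (w : E d × ℝ → ℝ) : Prop :=
  MemLp w 2 (wMeas Ω (1 - 2 * s)) ∧ ∃ φ, Approx Ω s φ w

/-- `F` is the weak (distributional) gradient `∇_{xt} w` in `Q`. -/
def HasWeakGrad {d : ℕ} (Ω : Set (E d)) (w : E d × ℝ → ℝ) (F : E d × ℝ → Vec d) : Prop :=
  LocallyIntegrableOn w (halfCyl Ω) ∧ LocallyIntegrableOn F (halfCyl Ω) ∧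
  ∀ ψ, IsCc (halfCyl Ω) ψ →
    ∫ z in halfCyl Ω, w z • gradXT ψ z = - ∫ z in halfCyl Ω, ψ z • F z

/-- `D` is the weak (distributional) divergence `div_{xt} 𝐲` in `Q`. -/
def HasWeakDiv {d : ℕ} (Ω : Set (E d)) (y : E d × ℝ → Vec d) (D : E d × ℝ → ℝ) : Prop :=
  LocallyIntegrableOn y (halfCyl Ω) ∧ LocallyIntegrableOn D (halfCyl Ω) ∧
  ∀ ψ, IsCc (halfCyl Ω) ψ →
    ∫ z in halfCyl Ω, ⟪y z, gradXT ψ z⟫ = - ∫ z in halfCyl Ω, D z * ψ z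

open Classical in
/-- The weak gradient `∇_{xt} w` (unique up to null sets). -/
noncomputable def grad {d : ℕ} (Ω : Set (E d)) (w : E d × ℝ → ℝ) : E d × ℝ → Vec d :=
  if h : ∃ F, HasWeakGrad Ω w F then h.choose else 0

open Classical in
/-- The weak divergence `div_{xt} 𝐲` (unique up to null sets). -/
noncomputable def divXT {d : ℕ} (Ω : Set (E d)) (y : E d × ℝ → Vec d) : E d × ℝ → ℝ :=
  if h : ∃ D, HasWeakDiv Ω y D then h.choose else 0

/-- `|||F|||_t² = ∫_Q t^{1-2s} |F|² dx dt`. -/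
noncomputable def normtSq {d : ℕ} (Ω : Set (E d)) (s : ℝ) (F : E d × ℝ → Vec d) : ℝ :=
  ∫ z in halfCyl Ω, z.2 ^ (1 - 2 * s) * ‖F z‖ ^ 2

/-- `v = w(·, 0)` is the trace of `w ∈ 𝓥` on `Ω × {0}`: the limit in `L²(Ω)` of the
restrictions `φ n (·, 0)` of smooth functions `φ n` approximating `w` in `𝓥`. -/
def HasTrace {d : ℕ} (Ω : Set (E d)) (s : ℝ) (w : E d × ℝ → ℝ) (v : E d → ℝ) : Prop :=
  MemLp w 2 (wMeas Ω (1 - 2 * s)) ∧ MemLp v 2 (volume.restrict Ω) ∧ ∃ φ, Approx Ω s φ w ∧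
    Tendsto (fun n => eLpNorm (fun x => φ n (x, 0) - v x) 2 (volume.restrict Ω)) atTop (𝓝 0)

theorem gradXT_eq {d : ℕ} {φ : E d × ℝ → ℝ} (h : ContDiff ℝ ∞ φ) (z : E d × ℝ) :
    gradXT φ z = WithLp.toLp 2 ((InnerProductSpace.toDual ℝ (E d)).symm
      ((fderiv ℝ φ z).comp (ContinuousLinearMap.inl ℝ (E d) ℝ)), fderiv ℝ φ z (0, 1)) := by
  have hd : HasFDerivAt φ (fderiv ℝ φ z) z :=
    ((h.differentiable (by simp)) z).hasFDerivAt
  have h1 : HasFDerivAt (fun x => φ (x, z.2))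
      ((fderiv ℝ φ z).comp (ContinuousLinearMap.inl ℝ (E d) ℝ)) z.1 :=
    HasFDerivAt.comp (g := φ) (f := fun x : E d => (x, z.2)) z.1 hd
      (hasFDerivAt_prodMk_left z.1 z.2)
  have h2 : HasFDerivAt (fun t => φ (z.1, t))
      ((fderiv ℝ φ z).comp (ContinuousLinearMap.inr ℝ (E d) ℝ)) z.2 :=
    HasFDerivAt.comp (g := φ) (f := fun t : ℝ => (z.1, t)) z.2 hd
      (hasFDerivAt_prodMk_right z.1 z.2)
  unfold gradXT gradient
  rw [h1.fderiv, h2.hasDerivAt.deriv]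
  simp

theorem continuous_gradXT {d : ℕ} {φ : E d × ℝ → ℝ} (h : ContDiff ℝ ∞ φ) :
    Continuous (gradXT φ) := by
  have hc : Continuous (fderiv ℝ φ) := h.continuous_fderiv (by simp)
  rw [funext (gradXT_eq h)]
  fun_prop

theorem gradXT_add {d : ℕ} {φ ψ : E d × ℝ → ℝ} (h : ContDiff ℝ ∞ φ) (k : ContDiff ℝ ∞ ψ) :
    gradXT (φ + ψ) = gradXT φ + gradXT ψ := by
  ext1 z
  rw [Pi.add_apply, gradXT_eq h, gradXT_eq k, gradXT_eq (φ := φ + ψ) (h.add k),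
    fderiv_add ((h.differentiable (by simp)) z) ((k.differentiable (by simp)) z),
    ← WithLp.toLp_add]
  simp [ContinuousLinearMap.add_comp]

theorem gradXT_smul {d : ℕ} {φ : E d × ℝ → ℝ} (h : ContDiff ℝ ∞ φ) (c : ℝ) :
    gradXT (c • φ) = c • gradXT φ := by
  ext1 z
  rw [Pi.smul_apply, gradXT_eq h, gradXT_eq (φ := c • φ) (h.const_smul c),
    fderiv_const_smul ((h.differentiable (by simp)) z), ← WithLp.toLp_smul]
  simp [ContinuousLinearMap.smul_comp]

theorem IsTest.add {d : ℕ} {Ω : Set (E d)} {φ ψ : E d × ℝ → ℝ} (h : IsTest Ω φ)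
    (k : IsTest Ω ψ) : IsTest Ω (φ + ψ) :=
  ⟨h.1.add k.1, h.2.1.add k.2.1, fun x hx t ht => by
    simp [h.2.2 x hx t ht, k.2.2 x hx t ht]⟩

theorem IsTest.smul {d : ℕ} {Ω : Set (E d)} {φ : E d × ℝ → ℝ} (h : IsTest Ω φ) (c : ℝ) :
    IsTest Ω (c • φ) :=
  ⟨h.1.const_smul c, h.2.1.smul_left (f := fun _ => c), fun x hx t ht => by
    simp [h.2.2 x hx t ht]⟩

theorem HasTrace.zero {d : ℕ} (Ω : Set (E d)) (s : ℝ) : HasTrace Ω s 0 0 := by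
  refine ⟨MemLp.zero, MemLp.zero, fun _ => 0, ⟨fun _ => ?_, fun ε _ => ⟨0, ?_⟩, ?_⟩, ?_⟩
  · exact ⟨contDiff_const, HasCompactSupport.zero, fun _ _ _ _ => rfl⟩
  · simp
  · simp
  · simp

theorem HasTrace.add {d : ℕ} {Ω : Set (E d)} {s : ℝ} {w w' : E d × ℝ → ℝ} {v v' : E d → ℝ}
    (h : HasTrace Ω s w v) (k : HasTrace Ω s w' v') : HasTrace Ω s (w + w') (v + v') := by
  obtain ⟨hw, hv, φ, ⟨h1, h2, h3⟩, h4⟩ := h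
  obtain ⟨kw, kv, ψ, ⟨k1, k2, k3⟩, k4⟩ := k
  refine ⟨hw.add kw, hv.add kv, fun n => φ n + ψ n, ⟨fun n => (h1 n).add (k1 n), ?_, ?_⟩, ?_⟩
  · intro ε hε
    obtain ⟨N, hN⟩ := h2 (ε / 2) (ENNReal.half_pos hε.ne')
    obtain ⟨M, hM⟩ := k2 (ε / 2) (ENNReal.half_pos hε.ne')
    refine ⟨max N M, fun m hm n hn => ?_⟩
    have e : gradXT (φ m + ψ m) - gradXT (φ n + ψ n)
        = (gradXT (φ m) - gradXT (φ n)) + (gradXT (ψ m) - gradXT (ψ n)) := by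
      rw [gradXT_add (h1 m).1 (k1 m).1, gradXT_add (h1 n).1 (k1 n).1]; abel
    rw [e]
    calc _ ≤ _ := eLpNorm_add_le
            ((continuous_gradXT (h1 m).1).sub (continuous_gradXT (h1 n).1)).aestronglyMeasurable
            ((continuous_gradXT (k1 m).1).sub (continuous_gradXT (k1 n).1)).aestronglyMeasurable
            (by norm_num)
      _ ≤ ε / 2 + ε / 2 := add_le_add
            (hN m (le_trans (le_max_left _ _) hm) n (le_trans (le_max_left _ _) hn))
            (hM m (le_trans (le_max_right _ _) hm) n (le_trans (le_max_right _ _) hn))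
      _ = ε := ENNReal.add_halves ε
  · have := h3.add k3
    rw [add_zero] at this
    refine tendsto_of_tendsto_of_tendsto_of_le_of_le tendsto_const_nhds this
      (fun _ => zero_le) (fun n => ?_)
    have e : φ n + ψ n - (w + w') = (φ n - w) + (ψ n - w') := by abel
    simp only [e]
    exact eLpNorm_add_le ((h1 n).1.continuous.aestronglyMeasurable.sub hw.1)
      ((k1 n).1.continuous.aestronglyMeasurable.sub kw.1) (by norm_num)
  · have := h4.add k4
    rw [add_zero] at this
    refine tendsto_of_tendsto_of_tendsto_of_le_of_le tendsto_const_nhds this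
      (fun _ => zero_le) (fun n => ?_)
    have e : (fun x => (φ n + ψ n) (x, 0) - (v + v') x)
        = (fun x => φ n (x, 0) - v x) + (fun x => ψ n (x, 0) - v' x) := by
      ext x; simp only [Pi.add_apply]; ring
    simp only [e]
    have c1 : Continuous (fun x => φ n (x, 0)) := (h1 n).1.continuous.comp (by fun_prop)
    have c2 : Continuous (fun x => ψ n (x, 0)) := (k1 n).1.continuous.comp (by fun_prop)
    exact eLpNorm_add_le (c1.aestronglyMeasurable.sub hv.1)
      (c2.aestronglyMeasurable.sub kv.1) (by norm_num)

theorem HasTrace.smul {d : ℕ} {Ω : Set (E d)} {s : ℝ} {w : E d × ℝ → ℝ} {v : E d → ℝ}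
    (h : HasTrace Ω s w v) (c : ℝ) : HasTrace Ω s (c • w) (c • v) := by
  obtain ⟨hw, hv, φ, ⟨h1, h2, h3⟩, h4⟩ := h
  refine ⟨hw.const_smul c, hv.const_smul c, fun n => c • φ n,
    ⟨fun n => (h1 n).smul c, ?_, ?_⟩, ?_⟩
  · intro ε hε
    rcases eq_or_ne c 0 with rfl | hc
    · refine ⟨0, fun m _ n _ => ?_⟩
      rw [gradXT_smul (h1 m).1, gradXT_smul (h1 n).1]
      simp
    · obtain ⟨N, hN⟩ := h2 (ε / ‖c‖ₑ) (ENNReal.div_pos hε.ne' enorm_ne_top)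
      refine ⟨N, fun m hm n hn => ?_⟩
      rw [gradXT_smul (h1 m).1, gradXT_smul (h1 n).1, ← smul_sub, eLpNorm_const_smul]
      calc _ ≤ ‖c‖ₑ * (ε / ‖c‖ₑ) := by gcongr; exact hN m hm n hn
        _ ≤ ε := ENNReal.mul_div_le
  · have := ENNReal.Tendsto.const_mul h3 (Or.inr (enorm_ne_top (x := c)))
    rw [mul_zero] at this
    refine this.congr (fun n => ?_)
    rw [← smul_sub, eLpNorm_const_smul]
  · have := ENNReal.Tendsto.const_mul h4 (Or.inr (enorm_ne_top (x := c)))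
    rw [mul_zero] at this
    refine this.congr (fun n => ?_)
    rw [← eLpNorm_const_smul]
    congr 1
    ext x
    simp [mul_sub]

theorem HasTrace.congr {d : ℕ} {Ω : Set (E d)} {s : ℝ} {w : E d × ℝ → ℝ} {v v' : E d → ℝ}
    (h : HasTrace Ω s w v) (e : v =ᵐ[volume.restrict Ω] v') : HasTrace Ω s w v' := by
  obtain ⟨hw, hv, φ, h1, h4⟩ := h
  refine ⟨hw, (memLp_congr_ae e).1 hv, φ, h1, h4.congr (fun n => eLpNorm_congr_ae ?_)⟩
  filter_upwards [e] with x hx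
  rw [hx]

/-- The trace space `{w(·, 0) : w ∈ 𝓥}`, a linear subspace of `L²(Ω)`. -/
def traceSpace {d : ℕ} (Ω : Set (E d)) (s : ℝ) :
    Submodule ℝ (Lp ℝ 2 (volume.restrict Ω)) where
  carrier := {v | ∃ w, HasTrace Ω s w v}
  zero_mem' := ⟨0, (HasTrace.zero Ω s).congr (Lp.coeFn_zero _ _ _).symm⟩
  add_mem' := by
    rintro v v' ⟨w, h⟩ ⟨w', k⟩
    exact ⟨w + w', (h.add k).congr (Lp.coeFn_add v v').symm⟩
  smul_mem' := by
    rintro c v ⟨w, h⟩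
    exact ⟨c • w, (h.smul c).congr (Lp.coeFn_smul c v).symm⟩

open Classical in
/-- The trace `w(·, 0)` of `w ∈ 𝓥`. -/
noncomputable def tr {d : ℕ} (Ω : Set (E d)) (s : ℝ) (w : E d × ℝ → ℝ) : traceSpace Ω s :=
  if h : ∃ v : Lp ℝ 2 (volume.restrict Ω), HasTrace Ω s w v then ⟨h.choose, w, h.choose_spec⟩
  else 0

/-- The dual of the trace space: the linear functionals that are bounded with respect to the
quotient norm `‖v‖ = inf {|||∇_{xt} w|||_t : w ∈ 𝓥, w(·, 0) = v}`. -/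
noncomputable def traceDual {d : ℕ} (Ω : Set (E d)) (s : ℝ) :
    Submodule ℝ (traceSpace Ω s →ₗ[ℝ] ℝ) where
  carrier := {G | ∃ C : ℝ, ∀ w, MemV Ω s w → |G (tr Ω s w)| ≤ C * √(normtSq Ω s (grad Ω w))}
  zero_mem' := ⟨0, fun w _ => by simp⟩
  add_mem' := by
    rintro G G' ⟨C, h⟩ ⟨C', k⟩
    refine ⟨C + C', fun w hw => ?_⟩
    rw [add_mul, LinearMap.add_apply]
    exact (abs_add_le _ _).trans (add_le_add (h w hw) (k w hw))
  smul_mem' := by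
    rintro c G ⟨C, h⟩
    refine ⟨|c| * C, fun w hw => ?_⟩
    rw [LinearMap.smul_apply, smul_eq_mul, abs_mul, mul_assoc]
    exact mul_le_mul_of_nonneg_left (h w hw) (abs_nonneg c)

/-- The functional `G` is given by a function `h` on `Ω`: `⟨G, v⟩ = ∫_Ω v h dx`. -/
def IsGivenBy {d : ℕ} {Ω : Set (E d)} {s : ℝ} (G : traceDual Ω s) (h : E d → ℝ) : Prop :=
  ∀ v : traceSpace Ω s, IntegrableOn (fun x => (v : Lp ℝ 2 (volume.restrict Ω)) x * h x) Ω ∧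
    G.1 v = ∫ x in Ω, (v : Lp ℝ 2 (volume.restrict Ω)) x * h x

/-- `w` is a weak solution of
`w_tt + (1-2s)/t w_t + Δ_x w = 0` in `Q`, `- lim_{t → 0+} t^{1-2s} w_t = g` in `Ω`,
`w = 0` on `Γ`. -/
def IsWeakSolution {d : ℕ} (Ω : Set (E d)) (s : ℝ) (g : traceDual Ω s) (w : E d × ℝ → ℝ) :
    Prop :=
  MemV Ω s w ∧ ∀ η, MemV Ω s η →
    (∫ z in halfCyl Ω, z.2 ^ (1 - 2 * s) * ⟪grad Ω w z, grad Ω η z⟫) - g.1 (tr Ω s η) = 0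

/-- The flux `𝐩 = t^{1-2s} ∇_{xt} w`. -/
noncomputable def flux {d : ℕ} (Ω : Set (E d)) (s : ℝ) (w : E d × ℝ → ℝ) : E d × ℝ → Vec d :=
  fun z => z.2 ^ (1 - 2 * s) • grad Ω w z

/-- The space `Y_div` of fluxes `𝐲` with `|||t^{2s-1} 𝐲|||_t² = ∫_Q t^{2s-1} |𝐲|² < ∞` and
`∫_Q t^{2s-1} |div_{xt} 𝐲|² < ∞`. -/
def MemYdiv {d : ℕ} (Ω : Set (E d)) (s : ℝ) (y : E d × ℝ → Vec d) : Prop :=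
  MemLp y 2 (wMeas Ω (2 * s - 1)) ∧ (∃ D, HasWeakDiv Ω y D) ∧
    MemLp (divXT Ω y) 2 (wMeas Ω (2 * s - 1))

/-- `N = y_{d+1}(·, 0)` in the sense of distributions on `Ω × {0}`, i.e. the Green formula
`∫_Q (𝐲 ⊙ ∇_{xt} φ + φ div_{xt} 𝐲) = - ⟨y_{d+1}(·, 0), φ(·, 0)⟩` holds for all
`φ ∈ C_c^∞(Ω × ℝ)`. -/
def IsNormalTrace {d : ℕ} (Ω : Set (E d)) (s : ℝ) (y : E d × ℝ → Vec d) (N : traceDual Ω s) :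
    Prop :=
  ∀ φ, IsCc (Ω ×ˢ univ) φ →
    ∫ z in halfCyl Ω, (⟪y z, gradXT φ z⟫ + φ z * divXT Ω y z) = - N.1 (tr Ω s φ)

open Classical in
/-- The boundary value `y_{d+1}(·, 0)` of a flux `𝐲 ∈ Y_div`. -/
noncomputable def normalTrace {d : ℕ} (Ω : Set (E d)) (s : ℝ) (y : E d × ℝ → Vec d) :
    traceDual Ω s :=
  if h : ∃ N, IsNormalTrace Ω s y N then h.choose else 0

end StingaTorrea

/-!
With `e = w' - w` and `Y = t^{2s-1} 𝐲`, one has `∇w' - Y = ∇e - (Y - ∇w)` almost everywhere, so the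
identity is the expansion of a square in the Hilbert space `L²(t^{1-2s} dx dt)`. The cross term is
`-2 ∫ 𝐲 ⊙ ∇e + 2 ∫ t^{1-2s} ∇w ⊙ ∇e`; its second part is `2 ⟨g, e(·, 0)⟩` by the weak formulation,
and its first part is given by the Green formula for `𝐲` and `e` (`MemV.green`). The work lies in
showing that the objects exist and that this Green formula holds on the whole energy space.

* Gradients. The fields `∇φ n` of an approximating sequence converge in `L²(t^{1-2s} dx dt)`, which
  is in duality with `L²(t^{2s-1} dx dt)`; hence the limit is the weak gradient, which is unique.
* Traces. The weighted fundamental theorem of calculus on vertical lines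
  (`enorm_sub_zero_sq_le`) bounds `φ(·, 0)` in `L²(Ω)` by `φ` and `∇φ` (`eLpNorm_trace_sq_le`). Thus
  traces exist and depend only on the function.
* Density. The functions of `C_c^∞(Ω × ℝ)` are dense in the energy space
  (`MemV.exists_isCc_approx`), for any open `Ω`: a test function `φ` is truncated near its zero set
  by `η(nφ)/n`, and the gradient converges because `∇φ = 0` almost everywhere on `{φ = 0}`. Density
  gives the uniqueness of the boundary value, and it carries Poincaré's inequality over to the
  energy space.
* Existence of the boundary value. The functional `w ↦ ∫_Q (𝐲 ⊙ ∇w + w div 𝐲)` is bounded by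
  Poincaré's inequality; it descends to the trace space because it vanishes on the functions with
  zero trace (`greenPairing_eq_zero`). Indeed, only the strip `t < R` contributes, up to a cut-off
  whose derivative `O(1/R)` is absorbed by Hardy's inequality `‖w‖_{t<R} ≤ C R ‖∇w‖`, and the norms
  of `𝐲` and of its divergence over the strip tend to `0` with `R`.
-/

namespace StingaTorrea

/-! ### Pairings in `L²` -/

section L2

variable {α H : Type*} [MeasurableSpace α] {μ : Measure α} [NormedAddCommGroup H]

theorem tendsto_eLpNorm_toReal {F : α → H} {G : ℕ → α → H}
    (hF : MemLp F 2 μ) (hG : ∀ n, MemLp (G n) 2 μ)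
    (h : Tendsto (fun n => eLpNorm (G n - F) 2 μ) atTop (𝓝 0)) :
    Tendsto (fun n => (eLpNorm (G n) 2 μ).toReal) atTop (𝓝 (eLpNorm F 2 μ).toReal) := by
  have h1 := (Lp.tendsto_Lp_iff_tendsto_eLpNorm'' G hG F hF).2 h
  simpa [Lp.norm_toLp] using h1.norm

theorem eLpNorm_two_sq {f : α → H} : eLpNorm f 2 μ ^ 2 = ∫⁻ z, ‖f z‖ₑ ^ 2 ∂μ := by
  rw [eLpNorm_eq_lintegral_rpow_enorm_toReal (by simp) (by simp), ← ENNReal.rpow_natCast,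
    ← ENNReal.rpow_mul]
  simp

theorem eLpNorm_congr_sub {F F' : α → H} {G : α → H} (h : F =ᵐ[μ] F') :
    eLpNorm (G - F) 2 μ = eLpNorm (G - F') 2 μ :=
  eLpNorm_congr_ae ((EventuallyEq.refl _ _).sub h)

/-- Convergence in `L²` follows from domination by a square integrable function. -/
theorem tendsto_eLpNorm_two_of_dominated {F : ℕ → α → H} {b : α → ℝ}
    (hF : ∀ n, AEStronglyMeasurable (F n) μ) (hb : MemLp b 2 μ)
    (hle : ∀ n, ∀ᵐ z ∂μ, ‖F n z‖ ≤ ‖b z‖)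
    (h : ∀ᵐ z ∂μ, Tendsto (fun n => F n z) atTop (𝓝 0)) :
    Tendsto (fun n => eLpNorm (F n) 2 μ) atTop (𝓝 0) := by
  have h2 : Tendsto (fun n => eLpNorm (F n) 2 μ ^ 2) atTop (𝓝 0) := by
    simp_rw [eLpNorm_two_sq]
    rw [show (0 : ℝ≥0∞) = ∫⁻ _, 0 ∂μ by simp]
    refine tendsto_lintegral_of_dominated_convergence' (fun z => ‖b z‖ₑ ^ 2)
      (fun n => (hF n).enorm.pow_const 2) (fun n => ?_) ?_ ?_
    · filter_upwards [hle n] with z hz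
      gcongr
      exact enorm_le_iff_norm_le.2 hz
    · rw [← eLpNorm_two_sq]
      exact (ENNReal.pow_lt_top hb.2).ne
    · filter_upwards [h] with z hz
      have := ENNReal.Tendsto.pow (n := 2) hz.enorm
      simpa using this
  have h3 := (ENNReal.continuous_rpow_const (y := 1/2)).tendsto 0 |>.comp h2
  simp only [Function.comp_def, ← ENNReal.rpow_natCast, ← ENNReal.rpow_mul] at h3
  simpa using h3

variable [InnerProductSpace ℝ H]

theorem abs_integral_inner_le {f g : α → H} (hf : MemLp f 2 μ) (hg : MemLp g 2 μ) :
    |∫ z, ⟪f z, g z⟫ ∂μ| ≤ (eLpNorm f 2 μ).toReal * (eLpNorm g 2 μ).toReal := by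
  have h := abs_real_inner_le_norm (hf.toLp f) (hg.toLp g)
  rw [Lp.norm_toLp, Lp.norm_toLp, L2.inner_def] at h
  refine le_of_eq_of_le ?_ h
  congr 1
  refine integral_congr_ae ?_
  filter_upwards [hf.coeFn_toLp, hg.coeFn_toLp] with z h1 h2
  rw [h1, h2]

theorem integrable_inner_of_memLp {f g : α → H} (hf : MemLp f 2 μ) (hg : MemLp g 2 μ) :
    Integrable (fun z => ⟪f z, g z⟫) μ := by
  refine (L2.integrable_inner (𝕜 := ℝ) (hf.toLp f) (hg.toLp g)).congr ?_
  filter_upwards [hf.coeFn_toLp, hg.coeFn_toLp] with z h1 h2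
  rw [h1, h2]

theorem tendsto_integral_inner {Y F : α → H} {G : ℕ → α → H} (hY : MemLp Y 2 μ)
    (hF : MemLp F 2 μ) (hG : ∀ n, MemLp (G n) 2 μ)
    (h : Tendsto (fun n => eLpNorm (G n - F) 2 μ) atTop (𝓝 0)) :
    Tendsto (fun n => ∫ z, ⟪Y z, G n z⟫ ∂μ) atTop (𝓝 (∫ z, ⟪Y z, F z⟫ ∂μ)) := by
  rw [tendsto_iff_norm_sub_tendsto_zero]
  have h' := ((ENNReal.tendsto_toReal ENNReal.zero_ne_top).comp h).const_mul (eLpNorm Y 2 μ).toReal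
  rw [ENNReal.toReal_zero, mul_zero] at h'
  refine squeeze_zero (fun _ => norm_nonneg _) (fun n => ?_) h'
  rw [← integral_sub (integrable_inner_of_memLp hY (hG n)) (integrable_inner_of_memLp hY hF),
    Real.norm_eq_abs]
  simp_rw [← inner_sub_right]
  exact abs_integral_inner_le hY ((hG n).sub hF)

theorem integral_norm_sq_eq {f : α → H} (hf : MemLp f 2 μ) :
    ∫ z, ‖f z‖ ^ 2 ∂μ = (eLpNorm f 2 μ).toReal ^ 2 := by
  rw [← Lp.norm_toLp f hf, ← real_inner_self_eq_norm_sq, L2.inner_def]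
  refine integral_congr_ae ?_
  filter_upwards [hf.coeFn_toLp] with z h1
  rw [h1, real_inner_self_eq_norm_sq]

end L2

/-! ### Calculus of the classical gradient -/

variable {d : ℕ}

theorem inner_gradXT {φ : E d × ℝ → ℝ} (h : ContDiff ℝ ∞ φ) (z : E d × ℝ) (c : Vec d) :
    ⟪c, gradXT φ z⟫ = fderiv ℝ φ z (c.fst, c.snd) := by
  rw [gradXT_eq h, WithLp.prod_inner_apply]
  have : (c.fst, c.snd) = (c.fst, (0 : ℝ)) + c.snd • ((0 : E d), (1 : ℝ)) := by simp
  rw [this, map_add, map_smul]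
  rw [real_inner_comm, InnerProductSpace.toDual_symm_apply]
  simp [mul_comm]

theorem gradXT_eq_zero {φ : E d × ℝ → ℝ} (h : ContDiff ℝ ∞ φ) {z : E d × ℝ}
    (hz : fderiv ℝ φ z = 0) : gradXT φ z = 0 := by
  refine ext_inner_left ℝ fun c => ?_
  simp [inner_gradXT h, hz]

theorem gradXT_congr {φ ψ : E d × ℝ → ℝ} (h : ContDiff ℝ ∞ φ) (k : ContDiff ℝ ∞ ψ)
    {z : E d × ℝ} (e : φ =ᶠ[𝓝 z] ψ) : gradXT φ z = gradXT ψ z := by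
  rw [gradXT_eq h, gradXT_eq k, e.fderiv_eq]

theorem gradXT_sub {φ ψ : E d × ℝ → ℝ} (h : ContDiff ℝ ∞ φ) (k : ContDiff ℝ ∞ ψ) :
    gradXT (φ - ψ) = gradXT φ - gradXT ψ := by
  ext1 z
  refine ext_inner_left ℝ fun c => ?_
  rw [Pi.sub_apply, inner_sub_right, inner_gradXT h, inner_gradXT k,
    inner_gradXT (φ := φ - ψ) (h.sub k),
    fderiv_sub (h.differentiable (by simp) z) (k.differentiable (by simp) z)]
  simp

theorem gradXT_mul {φ ψ : E d × ℝ → ℝ} (h : ContDiff ℝ ∞ φ) (k : ContDiff ℝ ∞ ψ)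
    (z : E d × ℝ) : gradXT (φ * ψ) z = φ z • gradXT ψ z + ψ z • gradXT φ z := by
  refine ext_inner_left ℝ fun c => ?_
  rw [inner_add_right, inner_smul_right, inner_smul_right, inner_gradXT h, inner_gradXT k,
    inner_gradXT (φ := φ * ψ) (h.mul k),
    fderiv_mul (h.differentiable (by simp) z) (k.differentiable (by simp) z)]
  simp

theorem gradXT_comp {φ : E d × ℝ → ℝ} {η : ℝ → ℝ} (h : ContDiff ℝ ∞ φ) (k : ContDiff ℝ ∞ η)
    (z : E d × ℝ) : gradXT (η ∘ φ) z = deriv η (φ z) • gradXT φ z := by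
  refine ext_inner_left ℝ fun c => ?_
  rw [inner_smul_right, inner_gradXT h, inner_gradXT (k.comp h),
    fderiv_comp _ (k.differentiable (by simp) _) (h.differentiable (by simp) z)]
  simp [mul_comm]

theorem support_gradXT_subset {φ : E d × ℝ → ℝ} (h : ContDiff ℝ ∞ φ) :
    Function.support (gradXT φ) ⊆ tsupport φ := by
  intro z hz
  by_contra hn
  exact hz (gradXT_eq_zero h (fderiv_of_notMem_tsupport ℝ hn))

theorem hasCompactSupport_gradXT {φ : E d × ℝ → ℝ} (h : ContDiff ℝ ∞ φ)
    (hc : HasCompactSupport φ) : HasCompactSupport (gradXT φ) :=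
  HasCompactSupport.of_support_subset_isCompact hc (support_gradXT_subset h)

theorem norm_fderiv_apply_le {φ : E d × ℝ → ℝ} (h : ContDiff ℝ ∞ φ) (z : E d × ℝ)
    {v : E d × ℝ} (hv : ‖v.1‖ ^ 2 + ‖v.2‖ ^ 2 ≤ 1) : ‖fderiv ℝ φ z v‖ ≤ ‖gradXT φ z‖ := by
  have h0 : fderiv ℝ φ z v = ⟪(WithLp.toLp 2 v : Vec d), gradXT φ z⟫ :=
    (inner_gradXT h z (WithLp.toLp 2 v)).symm
  rw [h0]
  refine (norm_inner_le_norm _ _).trans (mul_le_of_le_one_left (norm_nonneg _) ?_)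
  rw [WithLp.prod_norm_eq_of_L2]
  exact Real.sqrt_le_one.2 hv

/-! ### The weighted measures on the half-cylinder -/

theorem isOpen_halfCyl {Ω : Set (E d)} (hΩ : IsOpen Ω) : IsOpen (halfCyl Ω) :=
  hΩ.prod isOpen_Ioi

theorem measurable_weight (a : ℝ) :
    Measurable (fun z : E d × ℝ => ENNReal.ofReal (z.2 ^ a)) := by
  fun_prop

theorem ae_mem_halfCyl {Ω : Set (E d)} (hΩ : IsOpen Ω) :
    ∀ᵐ z ∂(volume.restrict (halfCyl Ω)), z ∈ halfCyl Ω :=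
  ae_restrict_mem (isOpen_halfCyl hΩ).measurableSet

theorem restrict_absolutelyContinuous_wMeas {Ω : Set (E d)} (hΩ : IsOpen Ω) (a : ℝ) :
    volume.restrict (halfCyl Ω) ≪ wMeas Ω a := by
  refine withDensity_absolutelyContinuous' (measurable_weight a).aemeasurable ?_
  filter_upwards [ae_mem_halfCyl hΩ] with z hz
  simpa using Real.rpow_pos_of_pos hz.2 a

theorem wMeas_absolutelyContinuous (Ω : Set (E d)) (a : ℝ) :
    wMeas Ω a ≪ volume.restrict (halfCyl Ω) :=
  withDensity_absolutelyContinuous _ _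

theorem ae_wMeas_iff {Ω : Set (E d)} (hΩ : IsOpen Ω) (a : ℝ) {p : E d × ℝ → Prop} :
    (∀ᵐ z ∂(wMeas Ω a), p z) ↔ ∀ᵐ z ∂(volume.restrict (halfCyl Ω)), p z :=
  ⟨fun h => (restrict_absolutelyContinuous_wMeas hΩ a).ae_le h,
    fun h => (wMeas_absolutelyContinuous Ω a).ae_le h⟩

theorem ae_wMeas_mem {Ω : Set (E d)} (hΩ : IsOpen Ω) (a : ℝ) :
    ∀ᵐ z ∂(wMeas Ω a), z ∈ halfCyl Ω :=
  (ae_wMeas_iff hΩ a).2 (ae_mem_halfCyl hΩ)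

theorem ae_wMeas_of_forall {Ω : Set (E d)} (hΩ : IsOpen Ω) (a : ℝ) {p : E d × ℝ → Prop}
    (h : ∀ z ∈ halfCyl Ω, p z) : ∀ᵐ z ∂(wMeas Ω a), p z :=
  (ae_wMeas_mem hΩ a).mono h

theorem lintegral_wMeas (Ω : Set (E d)) (a : ℝ) (f : E d × ℝ → ℝ≥0∞) :
    ∫⁻ z, f z ∂(wMeas Ω a) = ∫⁻ z in halfCyl Ω, ENNReal.ofReal (z.2 ^ a) * f z :=
  lintegral_withDensity_eq_lintegral_mul_non_measurable _ (measurable_weight a)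
    (by simp) f

theorem aestronglyMeasurable_wMeas_iff {H : Type*} [NormedAddCommGroup H] {Ω : Set (E d)} (hΩ : IsOpen Ω)
    (a b : ℝ) {f : E d × ℝ → H} :
    AEStronglyMeasurable f (wMeas Ω a) ↔ AEStronglyMeasurable f (wMeas Ω b) := by
  constructor <;> intro h <;>
  exact (h.mono_ac (restrict_absolutelyContinuous_wMeas hΩ _)).mono_ac
    (wMeas_absolutelyContinuous _ _)

section Normed

variable {H : Type*} [NormedAddCommGroup H] [NormedSpace ℝ H]

theorem integral_wMeas {Ω : Set (E d)} (hΩ : IsOpen Ω) (a : ℝ) (f : E d × ℝ → H) :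
    ∫ z, f z ∂(wMeas Ω a) = ∫ z in halfCyl Ω, z.2 ^ a • f z := by
  rw [wMeas, integral_withDensity_eq_integral_toReal_smul (measurable_weight a) (by simp)]
  refine integral_congr_ae ?_
  filter_upwards [ae_mem_halfCyl hΩ] with z hz
  rw [ENNReal.toReal_ofReal (Real.rpow_pos_of_pos hz.2 a).le]

theorem integrable_wMeas_iff {Ω : Set (E d)} (hΩ : IsOpen Ω) (a : ℝ) {f : E d × ℝ → H} :
    Integrable f (wMeas Ω a) ↔ IntegrableOn (fun z => z.2 ^ a • f z) (halfCyl Ω) := by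
  rw [wMeas, integrable_withDensity_iff_integrable_smul' (measurable_weight a) (by simp)]
  refine integrable_congr ?_
  filter_upwards [ae_mem_halfCyl hΩ] with z hz
  rw [ENNReal.toReal_ofReal (Real.rpow_pos_of_pos hz.2 a).le]

/-- Multiplication by `t^b` maps `L²(t^b dx dt)` isometrically onto `L²(t^{-b} dx dt)`. -/
theorem eLpNorm_rpow_smul {Ω : Set (E d)} (hΩ : IsOpen Ω) {a b : ℝ} (hab : a + b = 0)
    (f : E d × ℝ → H) :
    eLpNorm (fun z => z.2 ^ b • f z) 2 (wMeas Ω a) = eLpNorm f 2 (wMeas Ω b) := by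
  rw [eLpNorm_eq_lintegral_rpow_enorm_toReal (by simp) (by simp),
    eLpNorm_eq_lintegral_rpow_enorm_toReal (by simp) (by simp), lintegral_wMeas, lintegral_wMeas]
  congr 1
  refine setLIntegral_congr_fun (isOpen_halfCyl hΩ).measurableSet fun z hz => ?_
  have hz : 0 < z.2 := hz.2
  simp only [ENNReal.toReal_ofNat, ENNReal.rpow_ofNat]
  rw [enorm_smul, mul_pow, ← mul_assoc, Real.enorm_of_nonneg (Real.rpow_nonneg hz.le b),
    ← ENNReal.ofReal_pow (Real.rpow_nonneg hz.le b), ← ENNReal.ofReal_mul (by positivity), sq,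
    ← mul_assoc, ← Real.rpow_add hz, hab, Real.rpow_zero, one_mul]

theorem memLp_rpow_smul {Ω : Set (E d)} (hΩ : IsOpen Ω) {a b : ℝ} (hab : a + b = 0)
    {f : E d × ℝ → H} (hf : MemLp f 2 (wMeas Ω b)) :
    MemLp (fun z => z.2 ^ b • f z) 2 (wMeas Ω a) := by
  refine ⟨?_, by rw [eLpNorm_rpow_smul hΩ hab]; exact hf.2⟩
  refine AEStronglyMeasurable.smul ?_ ((aestronglyMeasurable_wMeas_iff hΩ _ _).1 hf.1)
  exact (by fun_prop : Measurable fun z : E d × ℝ => z.2 ^ b).aestronglyMeasurable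

/-- The Hölder inequality for the duality between `L²(t^a dx dt)` and `L²(t^{-a} dx dt)`. -/
theorem integrableOn_smul_of_memLp {Ω : Set (E d)} (hΩ : IsOpen Ω) {a b : ℝ} (hab : a + b = 0)
    {h : E d × ℝ → ℝ} {f : E d × ℝ → H} (hh : MemLp h 2 (wMeas Ω b))
    (hf : MemLp f 2 (wMeas Ω a)) : IntegrableOn (fun z => h z • f z) (halfCyl Ω) := by
  have h1 : Integrable (fun z => (z.2 ^ b • h z) • f z) (wMeas Ω a) :=
    memLp_one_iff_integrable.1 (MemLp.smul hf (memLp_rpow_smul hΩ hab hh))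
  refine ((integrable_wMeas_iff hΩ a).1 h1).congr_fun (fun z hz => ?_)
    (isOpen_halfCyl hΩ).measurableSet
  have hz : 0 < z.2 := hz.2
  simp only [smul_smul, smul_eq_mul, ← mul_assoc]
  rw [← Real.rpow_add hz, hab, Real.rpow_zero, one_mul]

theorem wMeas_lt_top_of_isCompact {Ω : Set (E d)} (a : ℝ) {K : Set (E d × ℝ)}
    (hK : IsCompact K) (hKQ : K ⊆ halfCyl Ω) : wMeas Ω a K < ⊤ := by
  have hc : ContinuousOn (fun z : E d × ℝ => z.2 ^ a) K := fun z hz =>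
    (continuous_snd.continuousAt.rpow_const (Or.inl (hKQ hz).2.ne')).continuousWithinAt
  have hi : IntegrableOn (fun z : E d × ℝ => z.2 ^ a) K := hc.integrableOn_compact hK
  rw [wMeas, withDensity_apply _ hK.measurableSet, Measure.restrict_restrict hK.measurableSet,
    inter_eq_left.2 hKQ]
  refine lt_of_le_of_lt (lintegral_mono fun z => ?_) hi.2
  exact Real.ofReal_le_enorm _

theorem locallyIntegrableOn_of_memLp {Ω : Set (E d)} (hΩ : IsOpen Ω) {a : ℝ} {f : E d × ℝ → H}
    (hf : MemLp f 2 (wMeas Ω a)) : LocallyIntegrableOn f (halfCyl Ω) := by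
  rw [locallyIntegrableOn_iff (isOpen_halfCyl hΩ).isLocallyClosed]
  intro K hKQ hK
  have h1 : MemLp (K.indicator fun _ => (1 : ℝ)) 2 (wMeas Ω (-a)) :=
    memLp_indicator_const 2 hK.measurableSet 1
      (Or.inr (wMeas_lt_top_of_isCompact _ hK hKQ).ne)
  have h2 := (integrableOn_smul_of_memLp hΩ (by ring) h1 hf).mono_set hKQ
  refine h2.congr_fun (fun z hz => ?_) hK.measurableSet
  simp [hz]

end Normed

/-- The measure `t ^ a dt` on the half-line. -/
noncomputable def wLine (a : ℝ) : Measure ℝ :=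
  (volume.restrict (Ioi 0)).withDensity (fun t => ENNReal.ofReal (t ^ a))

theorem wMeas_eq_prod (Ω : Set (E d)) (a : ℝ) :
    wMeas Ω a = (volume.restrict Ω).prod (wLine a) := by
  rw [wMeas, halfCyl, wLine, prod_withDensity_right (by fun_prop), Measure.prod_restrict,
    Measure.volume_eq_prod]

instance (a : ℝ) : SFinite (wLine a) := by unfold wLine; infer_instance

theorem wLine_Iio_lt_top {a : ℝ} (ha : -1 < a) (R : ℝ) : wLine a (Iio R) < ⊤ := by
  rw [wLine, withDensity_apply _ measurableSet_Iio, Measure.restrict_restrict measurableSet_Iio,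
    inter_comm, Ioi_inter_Iio]
  have h := (intervalIntegral.intervalIntegrable_rpow' (a := 0) (b := R) ha).1
  refine lt_of_le_of_lt ?_ h.2
  refine le_trans ?_ (lintegral_mono_set Ioo_subset_Ioc_self)
  exact lintegral_mono fun t => Real.ofReal_le_enorm _

theorem isFiniteMeasureOnCompacts_wMeas (Ω : Set (E d)) {a : ℝ} (ha : -1 < a) :
    IsFiniteMeasureOnCompacts (wMeas Ω a) := by
  have : IsFiniteMeasureOnCompacts (wLine a) := ⟨fun K hK => by
    obtain ⟨R, hR⟩ := hK.bddAbove
    exact lt_of_le_of_lt (measure_mono fun t ht => lt_of_le_of_lt (hR ht) (lt_add_one R))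
      (wLine_Iio_lt_top ha (R + 1))⟩
  rw [wMeas_eq_prod]
  infer_instance

theorem memLp_of_continuous {H : Type*} [NormedAddCommGroup H] (Ω : Set (E d)) {a : ℝ}
    (ha : -1 < a) {f : E d × ℝ → H} (hf : Continuous f) (hc : HasCompactSupport f) :
    MemLp f 2 (wMeas Ω a) :=
  have := isFiniteMeasureOnCompacts_wMeas Ω ha
  hf.memLp_of_hasCompactSupport hc

theorem memLp_gradXT (Ω : Set (E d)) {a : ℝ} (ha : -1 < a) {φ : E d × ℝ → ℝ}
    (hf : ContDiff ℝ ∞ φ) (hc : HasCompactSupport φ) : MemLp (gradXT φ) 2 (wMeas Ω a) :=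
  memLp_of_continuous Ω ha (continuous_gradXT hf) (hasCompactSupport_gradXT hf hc)

section Duality

variable {H : Type*} [NormedAddCommGroup H] [NormedSpace ℝ H]

theorem norm_setIntegral_smul_le {Ω : Set (E d)} (hΩ : IsOpen Ω) {a b : ℝ} (hab : a + b = 0)
    {h : E d × ℝ → ℝ} {f : E d × ℝ → H} (hh : MemLp h 2 (wMeas Ω b))
    (hf : MemLp f 2 (wMeas Ω a)) :
    ‖∫ z in halfCyl Ω, h z • f z‖ ≤
      (eLpNorm h 2 (wMeas Ω b)).toReal * (eLpNorm f 2 (wMeas Ω a)).toReal := by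
  have e : ∫ z in halfCyl Ω, h z • f z = ∫ z, (z.2 ^ b • h z) • f z ∂(wMeas Ω a) := by
    rw [integral_wMeas hΩ]
    refine setIntegral_congr_fun (isOpen_halfCyl hΩ).measurableSet fun z hz => ?_
    have hz : 0 < z.2 := hz.2
    simp only [smul_smul, smul_eq_mul, ← mul_assoc]
    rw [← Real.rpow_add hz, hab, Real.rpow_zero, one_mul]
  have hm := memLp_rpow_smul hΩ hab hh
  have h2 := abs_integral_inner_le hm.norm hf.norm
  rw [eLpNorm_norm, eLpNorm_norm, eLpNorm_rpow_smul hΩ hab] at h2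
  rw [e]
  refine (norm_integral_le_integral_norm _).trans ((le_of_eq ?_).trans ((le_abs_self _).trans h2))
  refine integral_congr_ae (Eventually.of_forall fun z => ?_)
  simp [norm_smul, mul_comm]

theorem tendsto_setIntegral_smul_right {Ω : Set (E d)} (hΩ : IsOpen Ω) {a b : ℝ}
    (hab : a + b = 0) {h : E d × ℝ → ℝ} {f : E d × ℝ → H} {F : ℕ → E d × ℝ → H}
    (hh : MemLp h 2 (wMeas Ω b)) (hf : MemLp f 2 (wMeas Ω a))
    (hF : ∀ n, MemLp (F n) 2 (wMeas Ω a))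
    (hl : Tendsto (fun n => eLpNorm (F n - f) 2 (wMeas Ω a)) atTop (𝓝 0)) :
    Tendsto (fun n => ∫ z in halfCyl Ω, h z • F n z) atTop
      (𝓝 (∫ z in halfCyl Ω, h z • f z)) := by
  rw [tendsto_iff_norm_sub_tendsto_zero]
  have h' := ((ENNReal.tendsto_toReal ENNReal.zero_ne_top).comp hl).const_mul
    (eLpNorm h 2 (wMeas Ω b)).toReal
  rw [ENNReal.toReal_zero, mul_zero] at h'
  refine squeeze_zero (fun _ => norm_nonneg _) (fun n => ?_) h'
  rw [← integral_sub (integrableOn_smul_of_memLp hΩ hab hh (hF n))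
    (integrableOn_smul_of_memLp hΩ hab hh hf)]
  simp_rw [← smul_sub]
  exact norm_setIntegral_smul_le hΩ hab hh ((hF n).sub hf)

theorem tendsto_setIntegral_smul_left {Ω : Set (E d)} (hΩ : IsOpen Ω) {a b : ℝ}
    (hab : a + b = 0) {h : E d × ℝ → ℝ} {f : E d × ℝ → H} {F : ℕ → E d × ℝ → ℝ}
    (hh : MemLp h 2 (wMeas Ω b)) (hf : MemLp f 2 (wMeas Ω a))
    (hF : ∀ n, MemLp (F n) 2 (wMeas Ω b))
    (hl : Tendsto (fun n => eLpNorm (F n - h) 2 (wMeas Ω b)) atTop (𝓝 0)) :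
    Tendsto (fun n => ∫ z in halfCyl Ω, F n z • f z) atTop
      (𝓝 (∫ z in halfCyl Ω, h z • f z)) := by
  rw [tendsto_iff_norm_sub_tendsto_zero]
  have h' := ((ENNReal.tendsto_toReal ENNReal.zero_ne_top).comp hl).mul_const
    (eLpNorm f 2 (wMeas Ω a)).toReal
  rw [ENNReal.toReal_zero, zero_mul] at h'
  refine squeeze_zero (fun _ => norm_nonneg _) (fun n => ?_) h'
  rw [← integral_sub (integrableOn_smul_of_memLp hΩ hab (hF n) hf)
    (integrableOn_smul_of_memLp hΩ hab hh hf)]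
  simp_rw [← sub_smul]
  exact norm_setIntegral_smul_le hΩ hab ((hF n).sub hh) hf

end Duality

/-! ### Weak gradients -/

instance : (volume : Measure (E d × ℝ)).IsAddHaarMeasure :=
  Measure.prod.instIsAddHaarMeasure volume volume

theorem setIntegral_eq_integral_of_tsupport {H : Type*} [NormedAddCommGroup H] [NormedSpace ℝ H]
    {U K : Set (E d × ℝ)} (hK : K ⊆ U) {f : E d × ℝ → H} (hf : ∀ z ∉ K, f z = 0) :
    ∫ z in U, f z = ∫ z, f z :=
  setIntegral_eq_integral_of_forall_compl_eq_zero fun z hz => hf z fun h => hz (hK h)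

theorem integral_smul_gradXT {φ ψ : E d × ℝ → ℝ} (h : ContDiff ℝ ∞ φ)
    (k : ContDiff ℝ ∞ ψ) (hc : HasCompactSupport ψ) :
    ∫ z, φ z • gradXT ψ z = - ∫ z, ψ z • gradXT φ z := by
  have cφ := continuous_gradXT h
  have cψ := continuous_gradXT k
  have dψ := hasCompactSupport_gradXT k hc
  have i1 : Integrable (fun z => φ z • gradXT ψ z) :=
    (h.continuous.smul cψ).integrable_of_hasCompactSupport (dψ.smul_left)
  have i2 : Integrable (fun z => ψ z • gradXT φ z) :=
    (k.continuous.smul cφ).integrable_of_hasCompactSupport (hc.smul_right)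
  refine ext_inner_left ℝ fun c => ?_
  rw [inner_neg_right, ← integral_inner i1, ← integral_inner i2]
  have j1 := i1.const_inner (𝕜 := ℝ) c
  have j2 := i2.const_inner (𝕜 := ℝ) c
  simp_rw [inner_smul_right, inner_gradXT h, inner_gradXT k] at j1 j2 ⊢
  rw [integral_mul_fderiv_eq_neg_fderiv_mul_of_integrable]
  · simp_rw [mul_comm]
  · simpa only [mul_comm] using j2
  · exact j1
  · exact (h.continuous.mul k.continuous).integrable_of_hasCompactSupport hc.mul_left
  · exact fun z _ => h.differentiable (by simp) z
  · exact fun z _ => k.differentiable (by simp) z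

theorem setIntegral_smul_gradXT {U : Set (E d × ℝ)} {φ ψ : E d × ℝ → ℝ} (h : ContDiff ℝ ∞ φ)
    (k : IsCc U ψ) :
    ∫ z in U, φ z • gradXT ψ z = - ∫ z in U, ψ z • gradXT φ z := by
  have h0 : ∀ z ∉ tsupport ψ, ψ z = 0 := fun z => image_eq_zero_of_notMem_tsupport
  rw [setIntegral_eq_integral_of_tsupport k.2.2, setIntegral_eq_integral_of_tsupport k.2.2,
    integral_smul_gradXT h k.1 k.2.1]
  · intro z hz; rw [h0 z hz, zero_smul]
  · intro z hz
    rw [gradXT_eq_zero k.1 (fderiv_of_notMem_tsupport ℝ hz), smul_zero]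

theorem integrableOn_smul_of_isCc {H : Type*} [NormedAddCommGroup H] [NormedSpace ℝ H]
    {U : Set (E d × ℝ)} {F : E d × ℝ → H} (hF : LocallyIntegrableOn F U)
    {ψ : E d × ℝ → ℝ} (k : IsCc U ψ) : IntegrableOn (fun z => ψ z • F z) U := by
  have h1 : IntegrableOn F (tsupport ψ) := hF.integrableOn_compact_subset k.2.2 k.2.1
  have h2 : IntegrableOn (fun z => ψ z • F z) (tsupport ψ) :=
    h1.continuousOn_smul k.1.continuous.continuousOn k.2.1
  have h3 := (integrableOn_iff_integrable_of_support_subset (fun z hz => by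
    by_contra hn
    exact hz (by simp [image_eq_zero_of_notMem_tsupport hn]))).1 h2
  exact h3.integrableOn

theorem HasWeakGrad.ae_eq {Ω : Set (E d)} (hΩ : IsOpen Ω) {w : E d × ℝ → ℝ}
    {F F' : E d × ℝ → Vec d} (h : HasWeakGrad Ω w F) (h' : HasWeakGrad Ω w F') :
    F =ᵐ[volume.restrict (halfCyl Ω)] F' := by
  have hQ := isOpen_halfCyl hΩ
  have key := hQ.ae_eq_zero_of_integral_contDiff_smul_eq_zero (μ := volume)
    (h.2.1.sub h'.2.1) (fun ψ h1 h2 h3 => by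
      have k : IsCc (halfCyl Ω) ψ := ⟨h1, h2, h3⟩
      rw [← setIntegral_eq_integral_of_tsupport h3 (fun z hz => by
        rw [image_eq_zero_of_notMem_tsupport hz, zero_smul])]
      simp only [Pi.sub_apply, smul_sub]
      rw [integral_sub (integrableOn_smul_of_isCc h.2.1 k)
        (integrableOn_smul_of_isCc h'.2.1 k), sub_eq_zero]
      have e := h.2.2 ψ k
      rw [h'.2.2 ψ k, neg_inj] at e
      exact e.symm)
  filter_upwards [ae_restrict_of_ae key, ae_mem_halfCyl hΩ] with z hz hm
  exact sub_eq_zero.1 (hz hm)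

theorem hasWeakGrad_of_tendsto {Ω : Set (E d)} (hΩ : IsOpen Ω) {a : ℝ} (ha : -1 < a)
    (ha' : a < 1) {φ : ℕ → E d × ℝ → ℝ} {w : E d × ℝ → ℝ} {F : E d × ℝ → Vec d}
    (hφ : ∀ n, ContDiff ℝ ∞ (φ n)) (hc : ∀ n, HasCompactSupport (φ n))
    (hw : MemLp w 2 (wMeas Ω a)) (hF : MemLp F 2 (wMeas Ω a))
    (h1 : Tendsto (fun n => eLpNorm (φ n - w) 2 (wMeas Ω a)) atTop (𝓝 0))
    (h2 : Tendsto (fun n => eLpNorm (gradXT (φ n) - F) 2 (wMeas Ω a)) atTop (𝓝 0)) :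
    HasWeakGrad Ω w F := by
  refine ⟨locallyIntegrableOn_of_memLp hΩ hw, locallyIntegrableOn_of_memLp hΩ hF,
    fun ψ k => ?_⟩
  have ha2 : -1 < -a := by linarith
  have t1 := tendsto_setIntegral_smul_left hΩ (a := -a) (by ring) hw
    (memLp_gradXT Ω ha2 k.1 k.2.1)
    (fun n => memLp_of_continuous Ω ha (hφ n).continuous (hc n)) h1
  have t2 := tendsto_setIntegral_smul_right hΩ (b := -a) (by ring)
    (memLp_of_continuous Ω ha2 k.1.continuous k.2.1) hF
    (fun n => memLp_gradXT Ω ha (hφ n) (hc n)) h2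
  refine tendsto_nhds_unique t1 (t2.neg.congr fun n => ?_)
  rw [setIntegral_smul_gradXT (hφ n) k]

theorem HasWeakGrad.grad_spec {Ω : Set (E d)} {w : E d × ℝ → ℝ} {F : E d × ℝ → Vec d}
    (h : HasWeakGrad Ω w F) : HasWeakGrad Ω w (grad Ω w) := by
  have h' : ∃ F, HasWeakGrad Ω w F := ⟨F, h⟩
  rw [grad, dif_pos h']
  exact h'.choose_spec

theorem HasWeakGrad.grad_ae_eq {Ω : Set (E d)} (hΩ : IsOpen Ω) (a : ℝ) {w : E d × ℝ → ℝ}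
    {F : E d × ℝ → Vec d} (h : HasWeakGrad Ω w F) : grad Ω w =ᵐ[wMeas Ω a] F :=
  (ae_wMeas_iff hΩ a).2 (h.grad_spec.ae_eq hΩ h)

/-! ### The trace inequality and the Hardy inequality -/

theorem enorm_sq_le (x y : ℝ) : ‖x‖ₑ ^ 2 ≤ 2 * ‖y‖ₑ ^ 2 + 2 * ‖x - y‖ₑ ^ 2 := by
  have e : ∀ r : ℝ, ‖r‖ₑ ^ 2 = ENNReal.ofReal (r ^ 2) := fun r => by
    rw [← sq_abs, ENNReal.ofReal_pow (abs_nonneg r), Real.enorm_eq_ofReal_abs]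
  have h2 : (2 : ℝ≥0∞) = ENNReal.ofReal 2 := by simp
  rw [e, e, e, h2, ← ENNReal.ofReal_mul (by norm_num), ← ENNReal.ofReal_mul (by norm_num),
    ← ENNReal.ofReal_add (by positivity) (by positivity)]
  apply ENNReal.ofReal_le_ofReal
  nlinarith [sq_nonneg (x - 2 * y)]

theorem lintegral_wLine (a : ℝ) (f : ℝ → ℝ≥0∞) :
    ∫⁻ t, f t ∂(wLine a) = ∫⁻ t in Ioi 0, ENNReal.ofReal (t ^ a) * f t :=
  lintegral_withDensity_eq_lintegral_mul_non_measurable _ (by fun_prop) (by simp) f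

theorem setLIntegral_rpow {b t : ℝ} (hb : -1 < b) (ht : 0 ≤ t) :
    ∫⁻ τ in Ioc 0 t, ENNReal.ofReal (τ ^ b) = ENNReal.ofReal (t ^ (b + 1) / (b + 1)) := by
  have h := (intervalIntegral.intervalIntegrable_rpow' (a := 0) (b := t) hb).1
  rw [← ofReal_integral_eq_lintegral_ofReal h, ← intervalIntegral.integral_of_le ht,
    integral_rpow (Or.inl hb), Real.zero_rpow (by linarith), sub_zero]
  filter_upwards [ae_restrict_mem measurableSet_Ioc] with τ hτ using Real.rpow_nonneg hτ.1.le b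

/-- The weighted fundamental theorem of calculus, from the Cauchy–Schwarz inequality. -/
theorem enorm_sub_zero_sq_le {a : ℝ} (ha : a < 1) {f f' : ℝ → ℝ}
    (hf : ∀ t, HasDerivAt f (f' t) t) (hc : Continuous f') {t : ℝ} (ht : 0 < t) :
    ‖f t - f 0‖ₑ ^ 2 ≤
      ENNReal.ofReal (t ^ (1 - a) / (1 - a)) * ∫⁻ τ, ‖f' τ‖ₑ ^ 2 ∂(wLine a) := by
  have h1 : f t - f 0 = ∫ τ in (0 : ℝ)..t, f' τ :=
    (intervalIntegral.integral_eq_sub_of_hasDerivAt (fun x _ => hf x)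
      (hc.intervalIntegrable _ _)).symm
  rw [intervalIntegral.integral_of_le ht.le] at h1
  have h2 : ‖f t - f 0‖ₑ ≤ ∫⁻ τ in Ioc 0 t, ‖f' τ‖ₑ := by
    rw [h1]; exact enorm_integral_le_lintegral_enorm _
  -- split `1 = τ^{-a/2} τ^{a/2}`; the first factor is square integrable near `0` since `a < 1`
  have h3 : ∫⁻ τ in Ioc 0 t, ‖f' τ‖ₑ =
      ∫⁻ τ in Ioc 0 t, ((fun τ => ENNReal.ofReal (τ ^ (-a / 2))) *
        (fun τ => ENNReal.ofReal (τ ^ (a / 2)) * ‖f' τ‖ₑ)) τ := by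
    refine setLIntegral_congr_fun measurableSet_Ioc fun τ hτ => ?_
    simp only [Pi.mul_apply]
    rw [← mul_assoc, ← ENNReal.ofReal_mul (Real.rpow_nonneg hτ.1.le _), ← Real.rpow_add hτ.1]
    ring_nf
    simp
  have h4 := ENNReal.lintegral_mul_le_Lp_mul_Lq (volume.restrict (Ioc 0 t))
    Real.HolderConjugate.two_two (f := fun τ => ENNReal.ofReal (τ ^ (-a / 2)))
    (g := fun τ => ENNReal.ofReal (τ ^ (a / 2)) * ‖f' τ‖ₑ)
    (by fun_prop) (by fun_prop)
  rw [← h3] at h4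
  have e1 : ∫⁻ τ in Ioc 0 t, ENNReal.ofReal (τ ^ (-a / 2)) ^ (2 : ℝ) =
      ENNReal.ofReal (t ^ (1 - a) / (1 - a)) := by
    rw [show 1 - a = -a + 1 by ring, ← setLIntegral_rpow (by linarith) ht.le]
    refine setLIntegral_congr_fun measurableSet_Ioc fun τ hτ => ?_
    simp only [ENNReal.rpow_ofNat]
    rw [← ENNReal.ofReal_pow (Real.rpow_nonneg hτ.1.le _), ← Real.rpow_natCast,
      ← Real.rpow_mul hτ.1.le]
    norm_num
  have e2 : ∫⁻ τ in Ioc 0 t, (ENNReal.ofReal (τ ^ (a / 2)) * ‖f' τ‖ₑ) ^ (2 : ℝ) ≤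
      ∫⁻ τ, ‖f' τ‖ₑ ^ 2 ∂(wLine a) := by
    rw [lintegral_wLine]
    refine le_trans (le_of_eq ?_) (lintegral_mono_set (s := Ioc 0 t) Ioc_subset_Ioi_self)
    refine setLIntegral_congr_fun measurableSet_Ioc fun τ hτ => ?_
    simp only [ENNReal.rpow_ofNat]
    rw [mul_pow, ← ENNReal.ofReal_pow (Real.rpow_nonneg hτ.1.le _), ← Real.rpow_natCast,
      ← Real.rpow_mul hτ.1.le]
    norm_num
  rw [e1] at h4
  calc ‖f t - f 0‖ₑ ^ 2 ≤ (ENNReal.ofReal (t ^ (1 - a) / (1 - a)) ^ (1 / 2 : ℝ) *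
        (∫⁻ τ, ‖f' τ‖ₑ ^ 2 ∂(wLine a)) ^ (1 / 2 : ℝ)) ^ 2 := by
        gcongr
        refine h2.trans (h4.trans ?_)
        gcongr
    _ = _ := by
        rw [mul_pow, ← ENNReal.rpow_natCast, ← ENNReal.rpow_natCast, ← ENNReal.rpow_mul,
          ← ENNReal.rpow_mul]
        norm_num

theorem wLine_ae_pos (a : ℝ) : ∀ᵐ t ∂(wLine a), 0 < t :=
  (withDensity_absolutelyContinuous _ _).ae_le (ae_restrict_mem measurableSet_Ioi)

theorem setLIntegral_rpow_wLine_le {a : ℝ} (ha : a < 1) {R : ℝ} (hR : 0 < R) :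
    ∫⁻ t in Iio R, ENNReal.ofReal (t ^ (1 - a) / (1 - a)) ∂(wLine a) ≤
      ENNReal.ofReal (R ^ 2 / (1 - a)) := by
  rw [← lintegral_indicator measurableSet_Iio, lintegral_wLine]
  calc _ ≤ ∫⁻ t in Ioi 0, (Ioc 0 R).indicator (fun _ => ENNReal.ofReal (R / (1 - a))) t := by
        refine setLIntegral_mono' measurableSet_Ioi fun t ht => ?_
        have ht : 0 < t := ht
        by_cases hR' : t < R
        · rw [indicator_of_mem (show t ∈ Iio R from hR'),
            indicator_of_mem (show t ∈ Ioc 0 R from ⟨ht, hR'.le⟩),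
            ← ENNReal.ofReal_mul (Real.rpow_nonneg ht.le _), mul_div_assoc', ← Real.rpow_add ht,
            add_sub_cancel, Real.rpow_one]
          apply ENNReal.ofReal_le_ofReal
          have : 0 < 1 - a := by linarith
          gcongr
        · rw [indicator_of_notMem (show t ∉ Iio R from hR')]
          simp
    _ ≤ ∫⁻ t, (Ioc 0 R).indicator (fun _ => ENNReal.ofReal (R / (1 - a))) t :=
        setLIntegral_le_lintegral _ _
    _ = _ := by
        rw [lintegral_indicator measurableSet_Ioc, setLIntegral_const, Real.volume_Ioc, sub_zero,
          ← ENNReal.ofReal_mul (div_nonneg hR.le (by linarith))]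
        congr 1; ring

/-- Hardy's inequality on a line: near `0` a function is controlled by its value at `0`, with a
large constant, and by its derivative, with a constant of order `R²`. -/
theorem lintegral_wLine_Iio_le {a : ℝ} (ha : a < 1) {f f' : ℝ → ℝ}
    (hf : ∀ t, HasDerivAt f (f' t) t) (hc : Continuous f') {R : ℝ} (hR : 0 < R) :
    ∫⁻ t in Iio R, ‖f t‖ₑ ^ 2 ∂(wLine a) ≤ 2 * wLine a (Iio R) * ‖f 0‖ₑ ^ 2 +
      2 * ENNReal.ofReal (R ^ 2 / (1 - a)) * ∫⁻ τ, ‖f' τ‖ₑ ^ 2 ∂(wLine a) := by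
  set G := ∫⁻ τ, ‖f' τ‖ₑ ^ 2 ∂(wLine a)
  calc _ ≤ ∫⁻ t in Iio R, (2 * ‖f 0‖ₑ ^ 2 +
        (2 * ENNReal.ofReal (t ^ (1 - a) / (1 - a))) * G) ∂(wLine a) := by
        refine lintegral_mono_ae (ae_restrict_of_ae ?_)
        filter_upwards [wLine_ae_pos a] with t ht
        refine (enorm_sq_le (f t) (f 0)).trans ?_
        rw [mul_assoc]
        gcongr
        exact enorm_sub_zero_sq_le ha hf hc ht
    _ = 2 * wLine a (Iio R) * ‖f 0‖ₑ ^ 2 +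
        2 * (∫⁻ t in Iio R, ENNReal.ofReal (t ^ (1 - a) / (1 - a)) ∂(wLine a)) * G := by
        rw [lintegral_add_left (by fun_prop), lintegral_const, Measure.restrict_apply_univ,
          lintegral_mul_const _ (by fun_prop), lintegral_const_mul _ (by fun_prop)]
        ring
    _ ≤ _ := by
        gcongr
        exact setLIntegral_rpow_wLine_le ha hR

/-- The value at `0` is controlled by averaging the fundamental theorem of calculus over
`0 < t < 1`. -/
theorem wLine_mul_enorm_zero_le {a : ℝ} (ha : a < 1) {f f' : ℝ → ℝ}
    (hf : ∀ t, HasDerivAt f (f' t) t) (hc : Continuous f') :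
    wLine a (Iio 1) * ‖f 0‖ₑ ^ 2 ≤ 2 * (∫⁻ t, ‖f t‖ₑ ^ 2 ∂(wLine a)) +
      2 * ENNReal.ofReal (1 / (1 - a)) * ∫⁻ τ, ‖f' τ‖ₑ ^ 2 ∂(wLine a) := by
  set G := ∫⁻ τ, ‖f' τ‖ₑ ^ 2 ∂(wLine a)
  have hfc : Continuous f := continuous_iff_continuousAt.2 fun t => (hf t).continuousAt
  calc _ = ∫⁻ t in Iio 1, ‖f 0‖ₑ ^ 2 ∂(wLine a) := by
        rw [lintegral_const, Measure.restrict_apply_univ, mul_comm]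
    _ ≤ ∫⁻ t in Iio 1, (2 * ‖f t‖ₑ ^ 2 +
        (2 * ENNReal.ofReal (t ^ (1 - a) / (1 - a))) * G) ∂(wLine a) := by
        refine lintegral_mono_ae (ae_restrict_of_ae ?_)
        filter_upwards [wLine_ae_pos a] with t ht
        refine (enorm_sq_le (f 0) (f t)).trans ?_
        rw [mul_assoc, ← enorm_neg (f 0 - f t), neg_sub]
        gcongr
        exact enorm_sub_zero_sq_le ha hf hc ht
    _ = 2 * (∫⁻ t in Iio 1, ‖f t‖ₑ ^ 2 ∂(wLine a)) +
        2 * (∫⁻ t in Iio 1, ENNReal.ofReal (t ^ (1 - a) / (1 - a)) ∂(wLine a)) * G := by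
        rw [lintegral_add_left (by fun_prop), lintegral_const_mul _ (by fun_prop),
          lintegral_mul_const _ (by fun_prop), lintegral_const_mul _ (by fun_prop)]
    _ ≤ _ := by
        gcongr
        · exact Measure.restrict_le_self
        · exact (setLIntegral_rpow_wLine_le ha one_pos).trans_eq (by simp)

theorem hasDerivAt_slice {φ : E d × ℝ → ℝ} (h : ContDiff ℝ ∞ φ) (x : E d) (t : ℝ) :
    HasDerivAt (fun t => φ (x, t)) (fderiv ℝ φ (x, t) (0, 1)) t := by
  have h1 := ((h.differentiable (by simp)) (x, t)).hasFDerivAt.comp t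
    (hasFDerivAt_prodMk_right (𝕜 := ℝ) x t)
  simpa [Function.comp_def] using h1.hasDerivAt

theorem lintegral_fderiv_le {φ : E d × ℝ → ℝ} (h : ContDiff ℝ ∞ φ) (Ω : Set (E d)) (a : ℝ) :
    ∫⁻ x in Ω, ∫⁻ t, ‖fderiv ℝ φ (x, t) (0, 1)‖ₑ ^ 2 ∂(wLine a) ≤
      eLpNorm (gradXT φ) 2 (wMeas Ω a) ^ 2 := by
  have hc : Continuous (gradXT φ) := continuous_gradXT h
  rw [eLpNorm_two_sq, wMeas_eq_prod, lintegral_prod _ (by fun_prop)]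
  refine lintegral_mono fun x => lintegral_mono fun t => ?_
  gcongr
  exact enorm_le_iff_norm_le.2 (norm_fderiv_apply_le h (x, t) (v := (0, 1)) (by simp))

theorem continuous_fderiv_slice {φ : E d × ℝ → ℝ} (h : ContDiff ℝ ∞ φ) (x : E d) :
    Continuous fun t => fderiv ℝ φ (x, t) (0, 1) := by
  have : Continuous (fderiv ℝ φ) := h.continuous_fderiv (by simp)
  fun_prop

/-- Hardy's inequality near the bottom `t = 0` of the half-cylinder. -/
theorem eLpNorm_strip_sq_le {a : ℝ} (ha : a < 1) (Ω : Set (E d)) {φ : E d × ℝ → ℝ}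
    (h : ContDiff ℝ ∞ φ) {R : ℝ} (hR : 0 < R) :
    eLpNorm φ 2 ((wMeas Ω a).restrict (univ ×ˢ Iio R)) ^ 2 ≤
      2 * wLine a (Iio R) * eLpNorm (fun x => φ (x, 0)) 2 (volume.restrict Ω) ^ 2 +
      2 * ENNReal.ofReal (R ^ 2 / (1 - a)) * eLpNorm (gradXT φ) 2 (wMeas Ω a) ^ 2 := by
  have hc : Continuous φ := h.continuous
  have hc' : Continuous (fderiv ℝ φ) := h.continuous_fderiv (by simp)
  rw [eLpNorm_two_sq, wMeas_eq_prod, ← Measure.prod_restrict, Measure.restrict_univ,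
    lintegral_prod _ (by fun_prop), ← wMeas_eq_prod]
  calc _ ≤ ∫⁻ x in Ω, (2 * wLine a (Iio R) * ‖φ (x, 0)‖ₑ ^ 2 + 2 * ENNReal.ofReal (R ^ 2 / (1 - a))
        * ∫⁻ t, ‖fderiv ℝ φ (x, t) (0, 1)‖ₑ ^ 2 ∂(wLine a)) :=
        lintegral_mono fun x => lintegral_wLine_Iio_le ha (hasDerivAt_slice h x)
          (continuous_fderiv_slice h x) hR
    _ = 2 * wLine a (Iio R) * (∫⁻ x in Ω, ‖φ (x, 0)‖ₑ ^ 2) + 2 * ENNReal.ofReal (R ^ 2 / (1 - a))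
        * ∫⁻ x in Ω, ∫⁻ t, ‖fderiv ℝ φ (x, t) (0, 1)‖ₑ ^ 2 ∂(wLine a) := by
        have m1 : Measurable fun x => ‖φ (x, 0)‖ₑ ^ 2 :=
          (by fun_prop : Continuous fun x => ‖φ (x, 0)‖ₑ ^ 2).measurable
        rw [lintegral_add_left (m1.const_mul _), lintegral_const_mul _ m1,
          lintegral_const_mul]
        exact Measurable.lintegral_prod_right' (f := fun z => ‖fderiv ℝ φ z (0, 1)‖ₑ ^ 2)
          (by fun_prop)
    _ ≤ _ := by
        rw [← eLpNorm_two_sq]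
        gcongr
        exact lintegral_fderiv_le h Ω a

/-- The trace inequality. -/
theorem eLpNorm_trace_sq_le {a : ℝ} (ha : a < 1) (Ω : Set (E d)) {φ : E d × ℝ → ℝ}
    (h : ContDiff ℝ ∞ φ) :
    wLine a (Iio 1) * eLpNorm (fun x => φ (x, 0)) 2 (volume.restrict Ω) ^ 2 ≤
      2 * eLpNorm φ 2 (wMeas Ω a) ^ 2 +
      2 * ENNReal.ofReal (1 / (1 - a)) * eLpNorm (gradXT φ) 2 (wMeas Ω a) ^ 2 := by
  have hc : Continuous φ := h.continuous
  have hc' : Continuous (fderiv ℝ φ) := h.continuous_fderiv (by simp)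
  have m1 : Measurable fun x => ‖φ (x, 0)‖ₑ ^ 2 :=
    (by fun_prop : Continuous fun x => ‖φ (x, 0)‖ₑ ^ 2).measurable
  rw [eLpNorm_two_sq, ← lintegral_const_mul _ m1]
  calc _ ≤ ∫⁻ x in Ω, (2 * (∫⁻ t, ‖φ (x, t)‖ₑ ^ 2 ∂(wLine a)) + 2 * ENNReal.ofReal (1 / (1 - a))
        * ∫⁻ t, ‖fderiv ℝ φ (x, t) (0, 1)‖ₑ ^ 2 ∂(wLine a)) :=
        lintegral_mono fun x => wLine_mul_enorm_zero_le ha (hasDerivAt_slice h x)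
          (continuous_fderiv_slice h x)
    _ = 2 * (∫⁻ x in Ω, ∫⁻ t, ‖φ (x, t)‖ₑ ^ 2 ∂(wLine a)) + 2 * ENNReal.ofReal (1 / (1 - a))
        * ∫⁻ x in Ω, ∫⁻ t, ‖fderiv ℝ φ (x, t) (0, 1)‖ₑ ^ 2 ∂(wLine a) := by
        have m2 : Measurable fun x => ∫⁻ t, ‖φ (x, t)‖ₑ ^ 2 ∂(wLine a) :=
          Measurable.lintegral_prod_right' (f := fun z => ‖φ z‖ₑ ^ 2) (by fun_prop)
        rw [lintegral_add_left (m2.const_mul _), lintegral_const_mul _ m2,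
          lintegral_const_mul]
        exact Measurable.lintegral_prod_right' (f := fun z => ‖fderiv ℝ φ z (0, 1)‖ₑ ^ 2)
          (by fun_prop)
    _ ≤ _ := by
        gcongr
        · rw [eLpNorm_two_sq, wMeas_eq_prod, lintegral_prod _ (by fun_prop)]
        · exact lintegral_fderiv_le h Ω a

theorem wLine_Iio_ne_zero (a : ℝ) : wLine a (Iio 1) ≠ 0 := by
  have : volume.restrict (Ioi 0) ≪ wLine a := by
    refine withDensity_absolutelyContinuous' (by fun_prop) ?_
    filter_upwards [ae_restrict_mem measurableSet_Ioi] with t ht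
    simpa using Real.rpow_pos_of_pos ht a
  intro h0
  have h1 := this h0
  rw [Measure.restrict_apply measurableSet_Iio, inter_comm, Ioi_inter_Iio, Real.volume_Ioo] at h1
  simp at h1

/-- Functions that tend to `0` in the energy space, together with their gradients, have traces that
tend to `0`. -/
theorem tendsto_trace_zero {a : ℝ} (ha1 : -1 < a) (ha : a < 1) (Ω : Set (E d)) {ι : Type*}
    {l : Filter ι} {φ : ι → E d × ℝ → ℝ} (h : ∀ n, ContDiff ℝ ∞ (φ n))
    (h1 : Tendsto (fun n => eLpNorm (φ n) 2 (wMeas Ω a)) l (𝓝 0))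
    (h2 : Tendsto (fun n => eLpNorm (gradXT (φ n)) 2 (wMeas Ω a)) l (𝓝 0)) :
    Tendsto (fun n => eLpNorm (fun x => φ n (x, 0)) 2 (volume.restrict Ω)) l (𝓝 0) := by
  have hm := wLine_Iio_ne_zero a
  have hm' := (wLine_Iio_lt_top ha1 1).ne
  have t1 : Tendsto (fun n => 2 * eLpNorm (φ n) 2 (wMeas Ω a) ^ 2 +
      2 * ENNReal.ofReal (1 / (1 - a)) * eLpNorm (gradXT (φ n)) 2 (wMeas Ω a) ^ 2) l (𝓝 0) := by
    have e1 := ENNReal.Tendsto.const_mul (a := 2) (ENNReal.Tendsto.pow (n := 2) h1) (by simp)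
    have e2 := ENNReal.Tendsto.const_mul (a := 2 * ENNReal.ofReal (1 / (1 - a)))
      (ENNReal.Tendsto.pow (n := 2) h2) (Or.inr (ENNReal.mul_ne_top (by simp) (by simp)))
    simpa using e1.add e2
  have t2 := tendsto_of_tendsto_of_tendsto_of_le_of_le tendsto_const_nhds t1
    (fun _ => zero_le) (fun n => eLpNorm_trace_sq_le ha Ω (h n))
  have t3 := ENNReal.Tendsto.const_mul (a := (wLine a (Iio 1))⁻¹) t2
    (Or.inr (ENNReal.inv_ne_top.2 hm))
  simp only [← mul_assoc, ENNReal.inv_mul_cancel hm hm', one_mul, mul_zero] at t3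
  have h3 := (ENNReal.continuous_rpow_const (y := 1/2)).tendsto 0 |>.comp t3
  simp only [Function.comp_def, ← ENNReal.rpow_natCast, ← ENNReal.rpow_mul] at h3
  simpa using h3

/-! ### Completeness of the energy space, traces -/

section Cauchy

variable {α H : Type*} [MeasurableSpace α] {μ : Measure α} [NormedAddCommGroup H]

theorem exists_limit_of_cauchy_eLpNorm [CompleteSpace H] {f : ℕ → α → H}
    (hf : ∀ n, MemLp (f n) 2 μ)
    (h : ∀ ε : ℝ≥0∞, 0 < ε → ∃ N : ℕ, ∀ m, N ≤ m → ∀ n, N ≤ n → eLpNorm (f m - f n) 2 μ ≤ ε) :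
    ∃ F, MemLp F 2 μ ∧ Tendsto (fun n => eLpNorm (f n - F) 2 μ) atTop (𝓝 0) := by
  have hc : CauchySeq fun n => (hf n).toLp (f n) := by
    rw [Lp.cauchySeq_Lp_iff_cauchySeq_eLpNorm, ENNReal.tendsto_atTop_zero]
    intro ε hε
    obtain ⟨N, hN⟩ := h ε hε
    refine ⟨(N, N), fun n hn => ?_⟩
    refine le_of_eq_of_le (eLpNorm_congr_ae ?_) (hN n.1 hn.1 n.2 hn.2)
    exact (hf n.1).coeFn_toLp.sub (hf n.2).coeFn_toLp
  obtain ⟨F, hF⟩ := cauchySeq_tendsto_of_complete hc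
  refine ⟨F, Lp.memLp F, ?_⟩
  rw [← Lp.toLp_coeFn F (Lp.memLp F)] at hF
  exact (Lp.tendsto_Lp_iff_tendsto_eLpNorm'' f hf F (Lp.memLp F)).1 hF

theorem eLpNorm_sub_le_add {f g h : α → H} (hf : AEStronglyMeasurable f μ)
    (hg : AEStronglyMeasurable g μ) (hh : AEStronglyMeasurable h μ) :
    eLpNorm (f - g) 2 μ ≤ eLpNorm (f - h) 2 μ + eLpNorm (g - h) 2 μ := by
  have e : f - g = (f - h) - (g - h) := by abel
  rw [e]
  exact eLpNorm_sub_le (hf.sub hh) (hg.sub hh) (by norm_num)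

theorem cauchy_eLpNorm_of_tendsto {f : ℕ → α → H} {F : α → H} (hf : ∀ n, MemLp (f n) 2 μ)
    (hF : MemLp F 2 μ) (h : Tendsto (fun n => eLpNorm (f n - F) 2 μ) atTop (𝓝 0)) :
    ∀ ε : ℝ≥0∞, 0 < ε → ∃ N : ℕ, ∀ m, N ≤ m → ∀ n, N ≤ n → eLpNorm (f m - f n) 2 μ ≤ ε := by
  intro ε hε
  obtain ⟨N, hN⟩ := ENNReal.tendsto_atTop_zero.1 h (ε / 2) (ENNReal.half_pos hε.ne')
  refine ⟨N, fun m hm n hn => ?_⟩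
  refine (eLpNorm_sub_le_add (hf m).1 (hf n).1 hF.1).trans ?_
  exact (add_le_add (hN m hm) (hN n hn)).trans_eq (ENNReal.add_halves ε)

theorem tendsto_eLpNorm_sub {ι : Type*} {l : Filter ι} {f g : ι → α → H} {h : α → H}
    (hf : ∀ n, AEStronglyMeasurable (f n) μ) (hg : ∀ n, AEStronglyMeasurable (g n) μ)
    (hh : AEStronglyMeasurable h μ)
    (h1 : Tendsto (fun n => eLpNorm (f n - h) 2 μ) l (𝓝 0))
    (h2 : Tendsto (fun n => eLpNorm (g n - h) 2 μ) l (𝓝 0)) :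
    Tendsto (fun n => eLpNorm (f n - g n) 2 μ) l (𝓝 0) := by
  have := h1.add h2
  rw [add_zero] at this
  exact tendsto_of_tendsto_of_tendsto_of_le_of_le tendsto_const_nhds this (fun _ => zero_le)
    (fun n => eLpNorm_sub_le_add (hf n) (hg n) hh)

end Cauchy

section EnergySpace

variable {Ω : Set (E d)} {s : ℝ} {w w' : E d × ℝ → ℝ} {v v' : E d → ℝ}
  {φ ψ : ℕ → E d × ℝ → ℝ}

theorem IsTest.memLp {φ : E d × ℝ → ℝ} (h : IsTest Ω φ) (hs1 : s < 1) :
    MemLp φ 2 (wMeas Ω (1 - 2 * s)) :=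
  memLp_of_continuous Ω (by linarith) h.1.continuous h.2.1

theorem IsTest.memLp_gradXT {φ : E d × ℝ → ℝ} (h : IsTest Ω φ) (hs1 : s < 1) :
    MemLp (gradXT φ) 2 (wMeas Ω (1 - 2 * s)) :=
  StingaTorrea.memLp_gradXT Ω (by linarith) h.1 h.2.1

theorem IsTest.memLp_zero {φ : E d × ℝ → ℝ} (h : IsTest Ω φ) :
    MemLp (fun x => φ (x, 0)) 2 (volume.restrict Ω) := by
  refine Continuous.memLp_of_hasCompactSupport (h.1.continuous.comp (by fun_prop)) ?_
  refine HasCompactSupport.intro (IsCompact.image h.2.1 continuous_fst) fun x hx => ?_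
  exact image_eq_zero_of_notMem_tsupport fun hm => hx ⟨_, hm, rfl⟩

theorem Approx.exists_grad (h : Approx Ω s φ w) (hΩ : IsOpen Ω) (hs0 : 0 < s) (hs1 : s < 1)
    (hw : MemLp w 2 (wMeas Ω (1 - 2 * s))) :
    ∃ F, MemLp F 2 (wMeas Ω (1 - 2 * s)) ∧ HasWeakGrad Ω w F ∧
      Tendsto (fun n => eLpNorm (gradXT (φ n) - F) 2 (wMeas Ω (1 - 2 * s))) atTop (𝓝 0) := by
  obtain ⟨F, hF, hl⟩ := exists_limit_of_cauchy_eLpNorm (fun n => (h.1 n).memLp_gradXT hs1) h.2.1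
  exact ⟨F, hF, hasWeakGrad_of_tendsto hΩ (by linarith) (by linarith) (fun n => (h.1 n).1)
    (fun n => (h.1 n).2.1) hw hF h.2.2 hl, hl⟩

theorem MemV.hasWeakGrad (h : MemV Ω s w) (hΩ : IsOpen Ω) (hs0 : 0 < s) (hs1 : s < 1) :
    HasWeakGrad Ω w (grad Ω w) := by
  obtain ⟨hw, φ, hφ⟩ := h
  obtain ⟨F, -, hF, -⟩ := hφ.exists_grad hΩ hs0 hs1 hw
  exact hF.grad_spec

theorem MemV.memLp_grad (h : MemV Ω s w) (hΩ : IsOpen Ω) (hs0 : 0 < s) (hs1 : s < 1) :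
    MemLp (grad Ω w) 2 (wMeas Ω (1 - 2 * s)) := by
  obtain ⟨hw, φ, hφ⟩ := h
  obtain ⟨F, hF, hF', -⟩ := hφ.exists_grad hΩ hs0 hs1 hw
  exact (memLp_congr_ae (hF'.grad_ae_eq hΩ _)).2 hF

theorem Approx.tendsto_grad (h : Approx Ω s φ w) (hΩ : IsOpen Ω) (hs0 : 0 < s) (hs1 : s < 1)
    (hw : MemLp w 2 (wMeas Ω (1 - 2 * s))) :
    Tendsto (fun n => eLpNorm (gradXT (φ n) - grad Ω w) 2 (wMeas Ω (1 - 2 * s))) atTop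
      (𝓝 0) := by
  obtain ⟨F, hF, hF', hl⟩ := h.exists_grad hΩ hs0 hs1 hw
  exact hl.congr fun n => (eLpNorm_congr_sub (hF'.grad_ae_eq hΩ _)).symm

theorem Approx.of_tendsto {F : E d × ℝ → Vec d} (hs1 : s < 1) (hφ : ∀ n, IsTest Ω (φ n))
    (hF : MemLp F 2 (wMeas Ω (1 - 2 * s)))
    (h1 : Tendsto (fun n => eLpNorm (φ n - w) 2 (wMeas Ω (1 - 2 * s))) atTop (𝓝 0))
    (h2 : Tendsto (fun n => eLpNorm (gradXT (φ n) - F) 2 (wMeas Ω (1 - 2 * s))) atTop (𝓝 0)) :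
    Approx Ω s φ w :=
  ⟨hφ, cauchy_eLpNorm_of_tendsto (fun n => (hφ n).memLp_gradXT hs1) hF h2, h1⟩

/-- A test function is an element of the energy space, approximated by a constant sequence. -/
theorem IsTest.approx {φ : E d × ℝ → ℝ} (h : IsTest Ω φ) : Approx Ω s (fun _ => φ) φ :=
  ⟨fun _ => h, fun _ _ => ⟨0, fun _ _ _ _ => by simp⟩, by simp⟩

theorem IsTest.memV {φ : E d × ℝ → ℝ} (h : IsTest Ω φ) (hs1 : s < 1) : MemV Ω s φ :=
  ⟨h.memLp hs1, _, h.approx⟩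

theorem IsTest.grad_ae_eq {φ : E d × ℝ → ℝ} (h : IsTest Ω φ) (hΩ : IsOpen Ω) (hs0 : 0 < s)
    (hs1 : s < 1) : grad Ω φ =ᵐ[wMeas Ω (1 - 2 * s)] gradXT φ := by
  refine HasWeakGrad.grad_ae_eq hΩ _ (hasWeakGrad_of_tendsto hΩ (a := 1 - 2 * s) (by linarith)
    (by linarith) (φ := fun _ => φ) (fun _ => h.1) (fun _ => h.2.1) (h.memLp hs1)
    (h.memLp_gradXT hs1) ?_ ?_) <;> simp

/-- Two sequences approximating the same element of the energy space have asymptotically the same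
restrictions to `t = 0`. -/
theorem Approx.tendsto_trace_sub (h : Approx Ω s φ w) (k : Approx Ω s ψ w) (hΩ : IsOpen Ω)
    (hs0 : 0 < s) (hs1 : s < 1) (hw : MemLp w 2 (wMeas Ω (1 - 2 * s))) :
    Tendsto (fun n => eLpNorm (fun x => φ n (x, 0) - ψ n (x, 0)) 2 (volume.restrict Ω)) atTop
      (𝓝 0) := by
  obtain ⟨F, hF, hF', -⟩ := h.exists_grad hΩ hs0 hs1 hw
  have t1 := tendsto_eLpNorm_sub (fun n => ((h.1 n).memLp hs1).1)
    (fun n => ((k.1 n).memLp hs1).1) hw.1 h.2.2 k.2.2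
  have t2 := tendsto_eLpNorm_sub (fun n => ((h.1 n).memLp_gradXT hs1).1)
    (fun n => ((k.1 n).memLp_gradXT hs1).1)
    ((memLp_congr_ae (hF'.grad_ae_eq hΩ _)).2 hF).1 (h.tendsto_grad hΩ hs0 hs1 hw)
    (k.tendsto_grad hΩ hs0 hs1 hw)
  exact tendsto_trace_zero (a := 1 - 2 * s) (by linarith) (by linarith) Ω
    (φ := fun n => φ n - ψ n) (fun n => (h.1 n).1.sub (k.1 n).1) t1
    (t2.congr fun n => by rw [gradXT_sub (h.1 n).1 (k.1 n).1])

/-- The trace is the limit of the restrictions of every approximating sequence, not only of the one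
that defines it. -/
theorem HasTrace.tendsto (h : HasTrace Ω s w v) (k : Approx Ω s ψ w) (hΩ : IsOpen Ω)
    (hs0 : 0 < s) (hs1 : s < 1) :
    Tendsto (fun n => eLpNorm (fun x => ψ n (x, 0) - v x) 2 (volume.restrict Ω)) atTop
      (𝓝 0) := by
  obtain ⟨hw, hv, φ, hφ, hl⟩ := h
  have t := (k.tendsto_trace_sub hφ hΩ hs0 hs1 hw).add hl
  rw [add_zero] at t
  refine tendsto_of_tendsto_of_tendsto_of_le_of_le tendsto_const_nhds t (fun _ => zero_le)
    (fun n => ?_)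
  have e : (fun x => ψ n (x, 0) - v x) =
      (fun x => ψ n (x, 0) - φ n (x, 0)) + (fun x => φ n (x, 0) - v x) := by
    ext x; simp
  simp only [e]
  have m1 := (k.1 n).memLp_zero.1
  have m2 := (hφ.1 n).memLp_zero.1
  exact eLpNorm_add_le (m1.sub m2) (m2.sub hv.1) (by norm_num)

theorem HasTrace.ae_eq (h : HasTrace Ω s w v) (k : HasTrace Ω s w v') (hΩ : IsOpen Ω)
    (hs0 : 0 < s) (hs1 : s < 1) : v =ᵐ[volume.restrict Ω] v' := by
  obtain ⟨hw, hv, φ, hφ, hl⟩ := h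
  have hl' := k.tendsto hφ hΩ hs0 hs1
  have t := hl.add hl'
  rw [add_zero] at t
  have hle : eLpNorm (v - v') 2 (volume.restrict Ω) ≤ 0 := by
    refine ge_of_tendsto' t fun n => ?_
    have e : v - v' = (fun x => φ n (x, 0) - v' x) - (fun x => φ n (x, 0) - v x) := by
      ext x; simp
    rw [e, add_comm]
    have m2 := (hφ.1 n).memLp_zero.1
    exact eLpNorm_sub_le (m2.sub k.2.1.1) (m2.sub hv.1) (by norm_num)
  have h0 := (eLpNorm_eq_zero_iff (hv.1.sub k.2.1.1) (by simp)).1 (le_antisymm hle zero_le)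
  filter_upwards [h0] with x hx
  exact sub_eq_zero.1 hx

/-- By the trace inequality, the restrictions of an approximating sequence form a Cauchy sequence in
`L²(Ω)`. -/
theorem MemV.exists_hasTrace (h : MemV Ω s w) (hΩ : IsOpen Ω) (hs0 : 0 < s) (hs1 : s < 1) :
    ∃ v : Lp ℝ 2 (volume.restrict Ω), HasTrace Ω s w v := by
  obtain ⟨hw, φ, hφ⟩ := h
  have hp : Tendsto (fun p : ℕ × ℕ => p.1) atTop atTop := by
    rw [← prod_atTop_atTop_eq]; exact tendsto_fst
  have hq : Tendsto (fun p : ℕ × ℕ => p.2) atTop atTop := by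
    rw [← prod_atTop_atTop_eq]; exact tendsto_snd
  have hg := hφ.tendsto_grad hΩ hs0 hs1 hw
  have hgm := (MemV.memLp_grad ⟨hw, φ, hφ⟩ hΩ hs0 hs1).1
  have t1 := tendsto_eLpNorm_sub (l := atTop) (f := fun p : ℕ × ℕ => φ p.1) (g := fun p => φ p.2)
    (fun p => ((hφ.1 p.1).memLp hs1).1)
    (fun p => ((hφ.1 p.2).memLp hs1).1) hw.1 (hφ.2.2.comp hp) (hφ.2.2.comp hq)
  have t2 := tendsto_eLpNorm_sub (l := atTop) (f := fun p : ℕ × ℕ => gradXT (φ p.1))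
    (g := fun p => gradXT (φ p.2)) (fun p => ((hφ.1 p.1).memLp_gradXT hs1).1)
    (fun p => ((hφ.1 p.2).memLp_gradXT hs1).1) hgm (hg.comp hp) (hg.comp hq)
  have t3 := tendsto_trace_zero (a := 1 - 2 * s) (by linarith) (by linarith) Ω
    (φ := fun p : ℕ × ℕ => φ p.1 - φ p.2) (fun p => (hφ.1 p.1).1.sub (hφ.1 p.2).1) t1
    (t2.congr fun p => by rw [gradXT_sub (hφ.1 p.1).1 (hφ.1 p.2).1])
  obtain ⟨v, hv, hl⟩ := exists_limit_of_cauchy_eLpNorm (f := fun n x => φ n (x, 0))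
    (fun n => (hφ.1 n).memLp_zero) (fun ε hε => by
      obtain ⟨N, hN⟩ := ENNReal.tendsto_atTop_zero.1 t3 ε hε
      exact ⟨max N.1 N.2, fun m hm n hn => hN (m, n)
        ⟨(le_max_left _ _).trans hm, (le_max_right _ _).trans hn⟩⟩)
  exact ⟨hv.toLp v, HasTrace.congr ⟨hw, hv, φ, hφ, hl⟩ hv.coeFn_toLp.symm⟩

theorem HasTrace.memV (h : HasTrace Ω s w v) : MemV Ω s w :=
  let ⟨hw, _, φ, hφ, _⟩ := h
  ⟨hw, φ, hφ⟩

theorem MemV.hasTrace_tr (h : MemV Ω s w) (hΩ : IsOpen Ω) (hs0 : 0 < s) (hs1 : s < 1) :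
    HasTrace Ω s w (tr Ω s w : Lp ℝ 2 (volume.restrict Ω)) := by
  have h' := h.exists_hasTrace hΩ hs0 hs1
  rw [tr, dif_pos h']
  exact h'.choose_spec

theorem HasTrace.tr_eq {v : traceSpace Ω s}
    (h : HasTrace Ω s w (v : Lp ℝ 2 (volume.restrict Ω))) (hΩ : IsOpen Ω) (hs0 : 0 < s)
    (hs1 : s < 1) : tr Ω s w = v :=
  Subtype.ext (Lp.ext ((h.memV.hasTrace_tr hΩ hs0 hs1).ae_eq h hΩ hs0 hs1))

theorem exists_tr_eq (v : traceSpace Ω s) (hΩ : IsOpen Ω) (hs0 : 0 < s) (hs1 : s < 1) :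
    ∃ w, MemV Ω s w ∧ tr Ω s w = v :=
  let ⟨w, h⟩ := v.2
  ⟨w, HasTrace.memV h, HasTrace.tr_eq h hΩ hs0 hs1⟩

/-! ### Linearity of the gradient and of the trace -/

theorem MemV.add (h : MemV Ω s w) (k : MemV Ω s w') (hΩ : IsOpen Ω) (hs0 : 0 < s)
    (hs1 : s < 1) : MemV Ω s (w + w') :=
  ((h.hasTrace_tr hΩ hs0 hs1).add (k.hasTrace_tr hΩ hs0 hs1)).memV

theorem MemV.smul (h : MemV Ω s w) (c : ℝ) (hΩ : IsOpen Ω) (hs0 : 0 < s) (hs1 : s < 1) :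
    MemV Ω s (c • w) :=
  ((h.hasTrace_tr hΩ hs0 hs1).smul c).memV

theorem MemV.tr_add (h : MemV Ω s w) (k : MemV Ω s w') (hΩ : IsOpen Ω) (hs0 : 0 < s)
    (hs1 : s < 1) : tr Ω s (w + w') = tr Ω s w + tr Ω s w' :=
  HasTrace.tr_eq (((h.hasTrace_tr hΩ hs0 hs1).add (k.hasTrace_tr hΩ hs0 hs1)).congr
    (Lp.coeFn_add _ _).symm) hΩ hs0 hs1

theorem MemV.tr_smul (h : MemV Ω s w) (c : ℝ) (hΩ : IsOpen Ω) (hs0 : 0 < s) (hs1 : s < 1) :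
    tr Ω s (c • w) = c • tr Ω s w :=
  HasTrace.tr_eq (((h.hasTrace_tr hΩ hs0 hs1).smul c).congr
    (Lp.coeFn_smul _ _).symm) hΩ hs0 hs1

theorem MemV.grad_add (h : MemV Ω s w) (k : MemV Ω s w') (hΩ : IsOpen Ω) (hs0 : 0 < s)
    (hs1 : s < 1) : grad Ω (w + w') =ᵐ[wMeas Ω (1 - 2 * s)] grad Ω w + grad Ω w' := by
  have hg := h.hasWeakGrad hΩ hs0 hs1
  have kg := k.hasWeakGrad hΩ hs0 hs1
  refine HasWeakGrad.grad_ae_eq hΩ _ ⟨hg.1.add kg.1, hg.2.1.add kg.2.1, fun ψ hψ => ?_⟩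
  have m := memLp_gradXT Ω (a := -(1 - 2 * s)) (by linarith) hψ.1 hψ.2.1
  simp only [Pi.add_apply, add_smul, smul_add]
  rw [integral_add (integrableOn_smul_of_memLp hΩ (by ring) h.1 m)
      (integrableOn_smul_of_memLp hΩ (by ring) k.1 m), integral_add
      (integrableOn_smul_of_isCc hg.2.1 hψ) (integrableOn_smul_of_isCc kg.2.1 hψ),
      hg.2.2 ψ hψ, kg.2.2 ψ hψ]
  abel

theorem MemV.grad_smul (h : MemV Ω s w) (c : ℝ) (hΩ : IsOpen Ω) (hs0 : 0 < s)
    (hs1 : s < 1) : grad Ω (c • w) =ᵐ[wMeas Ω (1 - 2 * s)] c • grad Ω w := by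
  have hg := h.hasWeakGrad hΩ hs0 hs1
  refine HasWeakGrad.grad_ae_eq hΩ _ ⟨hg.1.smul c, hg.2.1.smul c, fun ψ hψ => ?_⟩
  simp only [Pi.smul_apply, smul_assoc, smul_comm _ c]
  rw [integral_smul, integral_smul, hg.2.2 ψ hψ, smul_neg]

theorem sub_eq_add_neg_one_smul {α : Type*} (f g : α → ℝ) : f - g = f + (-1 : ℝ) • g := by
  ext; simp [sub_eq_add_neg]

theorem MemV.sub (h : MemV Ω s w) (k : MemV Ω s w') (hΩ : IsOpen Ω) (hs0 : 0 < s)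
    (hs1 : s < 1) : MemV Ω s (w - w') := by
  rw [sub_eq_add_neg_one_smul]
  exact h.add (k.smul _ hΩ hs0 hs1) hΩ hs0 hs1

theorem MemV.tr_sub (h : MemV Ω s w) (k : MemV Ω s w') (hΩ : IsOpen Ω) (hs0 : 0 < s)
    (hs1 : s < 1) : tr Ω s (w - w') = tr Ω s w - tr Ω s w' := by
  rw [sub_eq_add_neg_one_smul, h.tr_add (k.smul _ hΩ hs0 hs1) hΩ hs0 hs1,
    k.tr_smul _ hΩ hs0 hs1, neg_one_smul, sub_eq_add_neg]

theorem MemV.grad_sub (h : MemV Ω s w) (k : MemV Ω s w') (hΩ : IsOpen Ω) (hs0 : 0 < s)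
    (hs1 : s < 1) : grad Ω (w - w') =ᵐ[wMeas Ω (1 - 2 * s)] grad Ω w - grad Ω w' := by
  rw [sub_eq_add_neg_one_smul]
  filter_upwards [h.grad_add (k.smul (-1) hΩ hs0 hs1) hΩ hs0 hs1,
    k.grad_smul (-1) hΩ hs0 hs1] with z h1 h2
  rw [h1, Pi.add_apply, h2]
  simp [sub_eq_add_neg]

theorem MemV.sqrt_normtSq (h : MemV Ω s w) (hΩ : IsOpen Ω) (hs0 : 0 < s) (hs1 : s < 1) :
    √(normtSq Ω s (grad Ω w)) = (eLpNorm (grad Ω w) 2 (wMeas Ω (1 - 2 * s))).toReal := by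
  have : normtSq Ω s (grad Ω w) = ∫ z, ‖grad Ω w z‖ ^ 2 ∂(wMeas Ω (1 - 2 * s)) :=
    (integral_wMeas hΩ _ _).symm
  rw [this, integral_norm_sq_eq (h.memLp_grad hΩ hs0 hs1), Real.sqrt_sq ENNReal.toReal_nonneg]

end EnergySpace

/-! ### Density of the smooth functions with compact support in `Ω × ℝ` -/

/-- The gradient of a smooth function vanishes almost everywhere on its zero set. -/
theorem ae_gradXT_eq_zero {φ : E d × ℝ → ℝ} (h : ContDiff ℝ ∞ φ) :
    ∀ᵐ z ∂(volume : Measure (E d × ℝ)), φ z = 0 → gradXT φ z = 0 := by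
  have hms : MeasurableSet {z | φ z = 0} :=
    (isClosed_eq h.continuous continuous_const).measurableSet
  let e : E d × ℝ := (0, 1)
  -- on the zero set, the map `φ • e` is approximated by the zero map without any error
  have hA : ApproximatesLinearOn (fun z => φ z • e) (0 : E d × ℝ →L[ℝ] E d × ℝ)
      {z | φ z = 0} 0 := fun x hx y hy => by
    simp [show φ x = 0 from hx, show φ y = 0 from hy]
  have key := hA.norm_fderiv_sub_le (volume : Measure (E d × ℝ)) hms
    (fun z => (fderiv ℝ φ z).smulRight e) (fun z _ =>
      ((h.differentiable (by simp) z).hasFDerivAt.smul_const e).hasFDerivWithinAt)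
  rw [ae_restrict_iff' hms] at key
  filter_upwards [key] with z hz hz0
  refine gradXT_eq_zero h ?_
  simpa [e] using hz hz0

/-- A smooth truncation: it vanishes near `0` and is the identity far from `0`. -/
theorem exists_truncation : ∃ η : ℝ → ℝ, ContDiff ℝ ∞ η ∧ (∀ u, |u| ≤ 1 → η u = 0) ∧
    (∀ u, 2 ≤ |u| → η u = u ∧ deriv η u = 1) ∧ (∀ u, |η u - u| ≤ |u|) ∧
    ∃ M, ∀ u, |deriv η u| ≤ M := by
  let η : ℝ → ℝ := fun u => u * Real.smoothTransition (u ^ 2 - 1)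
  have hη : ContDiff ℝ ∞ η :=
    contDiff_id.mul (Real.smoothTransition.contDiff.comp ((contDiff_id.pow 2).sub contDiff_const))
  have hid : ∀ u : ℝ, 2 < u ^ 2 → η u = u := fun u hu => by
    simp only [η]
    rw [Real.smoothTransition.one_of_one_le (by linarith), mul_one]
  have h4 : ∀ u : ℝ, 2 ≤ |u| → 2 < u ^ 2 := fun u hu => by
    rw [← sq_abs]; nlinarith
  have hd : ∀ u : ℝ, 2 < u ^ 2 → deriv η u = 1 := fun u hu => by
    have hn : ∀ᶠ x : ℝ in 𝓝 u, 2 < x ^ 2 :=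
      (isOpen_lt continuous_const (continuous_pow 2)).mem_nhds hu
    have : η =ᶠ[𝓝 u] id := hn.mono fun x hx => hid x hx
    rw [this.deriv_eq, deriv_id]
  refine ⟨η, hη, fun u hu => ?_, fun u hu => ⟨hid u (h4 u hu), hd u (h4 u hu)⟩, fun u => ?_, ?_⟩
  · simp only [η]
    rw [Real.smoothTransition.zero_of_nonpos, mul_zero]
    rw [← sq_abs]
    nlinarith [abs_nonneg u]
  · have e : η u - u = u * (Real.smoothTransition (u ^ 2 - 1) - 1) := by simp only [η]; ring
    rw [e, abs_mul]
    refine mul_le_of_le_one_right (abs_nonneg u) (abs_le.2 ⟨?_, ?_⟩)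
    · linarith [Real.smoothTransition.nonneg (u ^ 2 - 1)]
    · linarith [Real.smoothTransition.le_one (u ^ 2 - 1)]
  · have hc : Continuous (deriv η) := hη.continuous_deriv (by simp)
    obtain ⟨M, hM⟩ := (isCompact_Icc (a := (-2 : ℝ)) (b := 2)).exists_bound_of_continuousOn
      hc.continuousOn
    refine ⟨max M 1, fun u => ?_⟩
    by_cases hu : 2 ≤ |u|
    · rw [hd u (h4 u hu), abs_one]; exact le_max_right _ _
    · exact (hM u (abs_le.1 (not_le.1 hu).le)).trans (le_max_left _ _)

theorem exists_isCc_eq_one {K U : Set (E d × ℝ)} (hK : IsCompact K) (hU : IsOpen U)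
    (hKU : K ⊆ U) : ∃ χ, IsCc U χ ∧ ∀ z ∈ K, χ z = 1 := by
  obtain ⟨L, hL, hKL, hLU⟩ := exists_compact_between hK hU hKU
  obtain ⟨f, h1, h0, -⟩ := exists_contMDiffMap_one_nhds_of_subset_interior
    (n := (⊤ : ℕ∞)) (modelWithCornersSelf ℝ (E d × ℝ)) hK.isClosed hKL
  have hs : tsupport f ⊆ L := closure_minimal (fun z hz => by
    by_contra hn; exact hz (h0 z hn)) hL.isClosed
  exact ⟨f, ⟨f.contMDiff.contDiff, hL.of_isClosed_subset (isClosed_tsupport _) hs, hs.trans hLU⟩,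
    fun z hz => h1.self_of_nhdsSet z hz⟩

theorem IsCc.isTest {Ω : Set (E d)} (hΩ : IsOpen Ω) {φ : E d × ℝ → ℝ}
    (h : IsCc (Ω ×ˢ univ) φ) : IsTest Ω φ := by
  refine ⟨h.1, h.2.1, fun x hx t _ => image_eq_zero_of_notMem_tsupport fun hm => ?_⟩
  rw [hΩ.frontier_eq] at hx
  exact hx.2 (h.2.2 hm).1

/-- On the half-cylinder, the set where a test function is not small is a compact subset of
`Ω × ℝ`. -/
theorem IsTest.isCompact_superlevel {Ω : Set (E d)} (hΩ : IsOpen Ω) {φ : E d × ℝ → ℝ}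
    (h : IsTest Ω φ) {ε : ℝ} (hε : 0 < ε) :
    IsCompact ({z | ε ≤ |φ z|} ∩ closure Ω ×ˢ Ici 0) ∧
      {z | ε ≤ |φ z|} ∩ closure Ω ×ˢ Ici 0 ⊆ Ω ×ˢ univ := by
  have hc := h.1.continuous
  constructor
  · refine h.2.1.of_isClosed_subset ((isClosed_le continuous_const hc.abs).inter
      (isClosed_closure.prod isClosed_Ici)) fun z hz => subset_tsupport _ ?_
    rw [Function.mem_support]
    intro h0
    have hle : ε ≤ |φ z| := hz.1
    rw [h0, abs_zero] at hle
    linarith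
  · rintro ⟨x, t⟩ ⟨hz, hx, ht⟩
    refine ⟨?_, mem_univ _⟩
    by_contra hn
    have hf : x ∈ frontier Ω := by rw [hΩ.frontier_eq]; exact ⟨hx, hn⟩
    -- the values at `t = 0` vanish by continuity
    have hcl : IsClosed {t : ℝ | φ (x, t) = 0} :=
      isClosed_eq (hc.comp (by fun_prop)) continuous_const
    have h0 : φ (x, t) = 0 := by
      have hsub : closure (Ioi (0 : ℝ)) ⊆ {t : ℝ | φ (x, t) = 0} :=
        closure_minimal (fun t ht => h.2.2 x hf t ht) hcl
      rw [closure_Ioi] at hsub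
      exact hsub ht
    have hle : ε ≤ |φ (x, t)| := hz
    rw [h0, abs_zero] at hle
    linarith

/-- A truncation `η ∘ φ` of a test function agrees on the half-cylinder with a function of
`C_c^∞(Ω × ℝ)`; below `t = 0`, where `φ` need not vanish on `∂Ω`, the two may differ. -/
theorem IsTest.exists_isCc_eqOn {Ω : Set (E d)} (hΩ : IsOpen Ω) {φ : E d × ℝ → ℝ}
    (h : IsTest Ω φ) {η : ℝ → ℝ} (hη : ContDiff ℝ ∞ η) {ε : ℝ} (hε : 0 < ε)
    (h0 : ∀ u, |u| ≤ ε → η u = 0) :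
    ∃ ψ, IsCc (Ω ×ˢ univ) ψ ∧ EqOn ψ (η ∘ φ) (halfCyl Ω) := by
  obtain ⟨hK, hKU⟩ := h.isCompact_superlevel hΩ hε
  obtain ⟨χ, hχ, hχ1⟩ := exists_isCc_eq_one hK (hΩ.prod isOpen_univ) hKU
  refine ⟨χ * (η ∘ φ), ⟨hχ.1.mul (hη.comp h.1), hχ.2.1.mul_right,
    (tsupport_mul_subset_left).trans hχ.2.2⟩, fun z hz => ?_⟩
  by_cases hφ : ε ≤ |φ z|
  · rw [Pi.mul_apply, hχ1 z ⟨hφ, subset_closure hz.1, mem_Ici.2 (le_of_lt hz.2)⟩, one_mul]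
  · rw [Pi.mul_apply, Function.comp_apply, h0 _ (not_le.1 hφ).le, mul_zero]

/-- A test function is the limit in the energy norm of its truncations `η(nφ)/n`. -/
theorem IsTest.exists_isCc_tendsto {Ω : Set (E d)} (hΩ : IsOpen Ω) {s : ℝ} (hs1 : s < 1)
    {φ : E d × ℝ → ℝ} (h : IsTest Ω φ) : ∃ ψ : ℕ → E d × ℝ → ℝ, (∀ n, IsCc (Ω ×ˢ univ) (ψ n)) ∧
      Tendsto (fun n => eLpNorm (ψ n - φ) 2 (wMeas Ω (1 - 2 * s))) atTop (𝓝 0) ∧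
      Tendsto (fun n => eLpNorm (gradXT (ψ n) - gradXT φ) 2 (wMeas Ω (1 - 2 * s))) atTop
        (𝓝 0) := by
  obtain ⟨η, hη, hη0, hη1, hηb, M, hM⟩ := exists_truncation
  -- `η` rescaled to the size `1 / (n + 1)`
  let c : ℕ → ℝ := fun n => n + 1
  have hc : ∀ n, 0 < c n := fun n => by positivity
  let θ : ℕ → ℝ → ℝ := fun n u => (c n)⁻¹ * η (c n * u)
  have hθ : ∀ n, ContDiff ℝ ∞ (θ n) := fun n =>
    contDiff_const.mul (hη.comp (contDiff_const.mul contDiff_id))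
  have hθ0 : ∀ n u, |u| ≤ (c n)⁻¹ → θ n u = 0 := fun n u hu => by
    simp only [θ]
    rw [hη0, mul_zero]
    rw [abs_mul, abs_of_pos (hc n)]
    calc c n * |u| ≤ c n * (c n)⁻¹ := by gcongr
      _ = 1 := mul_inv_cancel₀ (hc n).ne'
  have hθb : ∀ n u, |θ n u - u| ≤ |u| := fun n u => by
    have e : θ n u - u = (c n)⁻¹ * (η (c n * u) - c n * u) := by
      simp only [θ]; field_simp [(hc n).ne']
    rw [e, abs_mul, abs_of_pos (inv_pos.2 (hc n))]
    calc (c n)⁻¹ * |η (c n * u) - c n * u| ≤ (c n)⁻¹ * |c n * u| :=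
          mul_le_mul_of_nonneg_left (hηb _) (inv_pos.2 (hc n)).le
      _ = |u| := by
          rw [abs_mul, abs_of_pos (hc n), ← mul_assoc, inv_mul_cancel₀ (hc n).ne', one_mul]
  have hθd : ∀ n u, deriv (θ n) u = deriv η (c n * u) := fun n u => by
    have h1 : HasDerivAt (fun u => c n * u) (c n) u := by
      simpa using (hasDerivAt_id u).const_mul (c n)
    have h2 := ((hη.differentiable (by simp) (c n * u)).hasDerivAt.comp u h1).const_mul (c n)⁻¹
    have h3 : HasDerivAt (θ n) ((c n)⁻¹ * (deriv η (c n * u) * c n)) u := h2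
    rw [h3.deriv]
    field_simp [(hc n).ne']
  have hθe : ∀ u, u ≠ 0 → ∀ᶠ n in atTop, θ n u = u ∧ deriv (θ n) u = 1 := fun u hu => by
    obtain ⟨N, hN⟩ := exists_nat_ge (2 / |u|)
    filter_upwards [eventually_ge_atTop N] with n hn
    have hn' : (N : ℝ) ≤ n := by exact_mod_cast hn
    have h2 : 2 ≤ |c n * u| := by
      rw [abs_mul, abs_of_pos (hc n), ← div_le_iff₀ (abs_pos.2 hu)]
      simp only [c]; linarith
    obtain ⟨e1, e2⟩ := hη1 _ h2
    refine ⟨?_, by rw [hθd, e2]⟩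
    simp only [θ]
    rw [e1, ← mul_assoc, inv_mul_cancel₀ (hc n).ne', one_mul]
  choose ψ hψ hψe using fun n => h.exists_isCc_eqOn hΩ (hθ n) (inv_pos.2 (hc n)) (hθ0 n)
  have hg : ∀ n, ∀ z ∈ halfCyl Ω, gradXT (ψ n) z = deriv (θ n) (φ z) • gradXT φ z :=
    fun n z hz => by
      rw [← gradXT_comp h.1 (hθ n)]
      exact gradXT_congr (hψ n).1 ((hθ n).comp h.1)
        (Filter.eventuallyEq_of_mem ((isOpen_halfCyl hΩ).mem_nhds hz) (hψe n))
  have hT : ∀ n, IsTest Ω (ψ n) := fun n => (hψ n).isTest hΩ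
  refine ⟨ψ, hψ, ?_, ?_⟩
  · refine tendsto_eLpNorm_two_of_dominated (b := φ)
      (fun n => (((hT n).memLp hs1).sub (h.memLp hs1)).1) (h.memLp hs1) (fun n => ?_) ?_
    · refine ae_wMeas_of_forall hΩ _ fun z hz => ?_
      rw [Pi.sub_apply, hψe n hz]
      exact hθb n (φ z)
    · refine ae_wMeas_of_forall hΩ _ fun z hz => ?_
      simp only [Pi.sub_apply, hψe _ hz, Function.comp_apply]
      by_cases h0 : φ z = 0
      · refine tendsto_const_nhds.congr fun n => ?_
        rw [h0, hθ0 n 0 (by simpa using (hc n).le), sub_zero]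
      · refine tendsto_const_nhds.congr' ?_
        filter_upwards [hθe _ h0] with n hn
        rw [hn.1, sub_self]
  · refine tendsto_eLpNorm_two_of_dominated (b := fun z => (M + 1) * ‖gradXT φ z‖)
      (fun n => (((hT n).memLp_gradXT hs1).sub (h.memLp_gradXT hs1)).1)
      ((h.memLp_gradXT hs1).norm.const_mul _) (fun n => ?_) ?_
    · refine ae_wMeas_of_forall hΩ _ fun z hz => ?_
      have e : deriv (θ n) (φ z) • gradXT φ z - gradXT φ z =
          (deriv (θ n) (φ z) - 1) • gradXT φ z := by rw [sub_smul, one_smul]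
      rw [Pi.sub_apply, hg n z hz, e, norm_smul]
      refine le_trans ?_ (le_abs_self _)
      gcongr
      rw [hθd]
      refine (norm_sub_le _ _).trans ?_
      rw [norm_one]
      gcongr
      exact hM _
    -- on `{φ = 0}` the gradients of the truncations vanish, and so does that of `φ` up to a null set
    · have hae : ∀ᵐ z ∂(wMeas Ω (1 - 2 * s)), φ z = 0 → gradXT φ z = 0 :=
        (ae_wMeas_iff hΩ _).2 (ae_restrict_of_ae (ae_gradXT_eq_zero h.1))
      filter_upwards [hae, ae_wMeas_mem hΩ _] with z hz hm
      simp only [Pi.sub_apply, hg _ z hm]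
      by_cases h0 : φ z = 0
      · simp [hz h0]
      · refine tendsto_const_nhds.congr' ?_
        filter_upwards [hθe _ h0] with n hn
        rw [hn.2, one_smul, sub_self]

/-- The smooth functions with compact support in `Ω × ℝ` are dense in the energy space. -/
theorem MemV.exists_isCc_approx {Ω : Set (E d)} {s : ℝ} {w : E d × ℝ → ℝ} (h : MemV Ω s w)
    (hΩ : IsOpen Ω) (hs0 : 0 < s) (hs1 : s < 1) :
    ∃ φ : ℕ → E d × ℝ → ℝ, (∀ n, IsCc (Ω ×ˢ univ) (φ n)) ∧ Approx Ω s φ w := by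
  obtain ⟨hw, φ, hφ⟩ := h
  have hg := MemV.memLp_grad ⟨hw, φ, hφ⟩ hΩ hs0 hs1
  have hl := hφ.tendsto_grad hΩ hs0 hs1 hw
  have hex : ∀ n : ℕ, ∃ ψ, IsCc (Ω ×ˢ univ) ψ ∧
      eLpNorm (ψ - φ n) 2 (wMeas Ω (1 - 2 * s)) ≤ (n : ℝ≥0∞)⁻¹ ∧
      eLpNorm (gradXT ψ - gradXT (φ n)) 2 (wMeas Ω (1 - 2 * s)) ≤ (n : ℝ≥0∞)⁻¹ := fun n => by
    obtain ⟨ψ, h1, h2, h3⟩ := (hφ.1 n).exists_isCc_tendsto hΩ hs1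
    have hpos : 0 < (n : ℝ≥0∞)⁻¹ := ENNReal.inv_pos.2 (ENNReal.natCast_ne_top n)
    obtain ⟨k, hk1, hk2⟩ := ((h2.eventually_lt_const hpos).and
      (h3.eventually_lt_const hpos)).exists
    exact ⟨ψ k, h1 k, hk1.le, hk2.le⟩
  choose ψ h1 h2 h3 using hex
  have hT : ∀ n, IsTest Ω (ψ n) := fun n => (h1 n).isTest hΩ
  have t0 := ENNReal.tendsto_inv_nat_nhds_zero
  refine ⟨ψ, h1, Approx.of_tendsto hs1 hT hg ?_ ?_⟩
  · have t := t0.add hφ.2.2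
    rw [add_zero] at t
    refine tendsto_of_tendsto_of_tendsto_of_le_of_le tendsto_const_nhds t (fun _ => zero_le)
      (fun n => ?_)
    rw [← sub_add_sub_cancel (ψ n) (φ n) w]
    exact (eLpNorm_add_le (((hT n).memLp hs1).1.sub ((hφ.1 n).memLp hs1).1)
      (((hφ.1 n).memLp hs1).1.sub hw.1) (by norm_num)).trans (add_le_add (h2 n) le_rfl)
  · have t := t0.add hl
    rw [add_zero] at t
    refine tendsto_of_tendsto_of_tendsto_of_le_of_le tendsto_const_nhds t (fun _ => zero_le)
      (fun n => ?_)
    rw [← sub_add_sub_cancel (gradXT (ψ n)) (gradXT (φ n)) (grad Ω w)]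
    exact (eLpNorm_add_le (((hT n).memLp_gradXT hs1).1.sub ((hφ.1 n).memLp_gradXT hs1).1)
      (((hφ.1 n).memLp_gradXT hs1).1.sub hg.1) (by norm_num)).trans (add_le_add (h3 n) le_rfl)

/-! ### The Poincaré inequality -/

/-- The Poincaré inequality in `ℝᵈ`, from an integration by parts against the coordinate `x i`,
whose derivative in the direction of `x i` is `1`. -/
theorem integral_sq_le {f : E d → ℝ} (hf : ContDiff ℝ ∞ f) (hc : HasCompactSupport f)
    (i : Fin d) {R : ℝ} (hR : ∀ x, f x ≠ 0 → |x i| ≤ R) :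
    ∫ x, f x ^ 2 ≤ 4 * R ^ 2 * ∫ x, fderiv ℝ f x (EuclideanSpace.single i 1) ^ 2 := by
  set e : E d := EuclideanSpace.single i 1
  have hfc := hf.continuous
  have hdc : Continuous fun x => fderiv ℝ f x e :=
    (hf.continuous_fderiv (by simp)).clm_apply continuous_const
  have hds : HasCompactSupport fun x => fderiv ℝ f x e := hc.fderiv_apply ℝ e
  let p : E d →L[ℝ] ℝ := EuclideanSpace.proj i
  have hp : ∀ x, fderiv ℝ p x e = 1 := fun x => by
    rw [p.fderiv]; simp [p, e]
  have hd2 : ∀ x, fderiv ℝ (fun x => f x ^ 2) x e = 2 * f x * fderiv ℝ f x e := fun x => by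
    rw [((hf.differentiable (by simp) x).hasFDerivAt.pow 2).fderiv]
    simp
  have i1 : Integrable fun x => f x ^ 2 :=
    (hfc.pow 2).integrable_of_hasCompactSupport (by
      simpa only [sq] using hc.mul_right (f' := f))
  have i2 : Integrable fun x => fderiv ℝ f x e ^ 2 :=
    (hdc.pow 2).integrable_of_hasCompactSupport (by
      simpa only [sq] using hds.mul_right (f' := fun x => fderiv ℝ f x e))
  have i3 : Integrable fun x => p x * (2 * f x * fderiv ℝ f x e) :=
    (p.continuous.mul ((continuous_const.mul hfc).mul hdc)).integrable_of_hasCompactSupport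
      (hds.mul_left.mul_left)
  have i4 : Integrable fun x => p x * f x ^ 2 :=
    (p.continuous.mul (hfc.pow 2)).integrable_of_hasCompactSupport (by
      simpa only [sq] using (hc.mul_right (f' := f)).mul_left)
  have key := integral_mul_fderiv_eq_neg_fderiv_mul_of_integrable (μ := volume)
    (f := p) (g := fun x => f x ^ 2) (v := e) (by simpa only [hp, one_mul] using i1)
    (by simpa only [hd2] using i3) i4 (fun x _ => p.differentiableAt)
    (fun x _ => (hf.differentiable (by simp) x).pow 2)
  simp only [hp, hd2, one_mul] at key
  have hle : ∫ x, -(p x * (2 * f x * fderiv ℝ f x e)) ≤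
      ∫ x, (1 / 2 * f x ^ 2 + 2 * R ^ 2 * fderiv ℝ f x e ^ 2) := by
    refine integral_mono i3.neg ((i1.const_mul _).add (i2.const_mul _)) fun x => ?_
    simp only
    by_cases h0 : f x = 0
    · rw [h0]
      have : 0 ≤ 2 * R ^ 2 * fderiv ℝ f x e ^ 2 := by positivity
      simpa using this
    · have hb : (p x) ^ 2 ≤ R ^ 2 := sq_le_sq' (abs_le.1 (hR x h0)).1 (abs_le.1 (hR x h0)).2
      nlinarith [sq_nonneg (f x + 2 * p x * fderiv ℝ f x e),
        mul_le_mul_of_nonneg_right hb (sq_nonneg (fderiv ℝ f x e))]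
  rw [integral_neg, key, neg_neg, integral_add (i1.const_mul _) (i2.const_mul _),
    integral_const_mul, integral_const_mul] at hle
  linarith

theorem lintegral_enorm_sq_eq {f : E d → ℝ} (hf : Continuous f) (hc : HasCompactSupport f) :
    ∫⁻ x, ‖f x‖ₑ ^ 2 = ENNReal.ofReal (∫ x, f x ^ 2) := by
  have e : ∀ r : ℝ, ‖r‖ₑ ^ 2 = ENNReal.ofReal (r ^ 2) := fun r => by
    rw [← sq_abs, ENNReal.ofReal_pow (abs_nonneg r), Real.enorm_eq_ofReal_abs]
  simp_rw [e]
  refine (ofReal_integral_eq_lintegral_ofReal ?_ (ae_of_all _ fun x => sq_nonneg _)).symm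
  exact (hf.pow 2).integrable_of_hasCompactSupport (by
      simpa only [sq] using hc.mul_right (f' := f))

/-- The Poincaré inequality for smooth functions with compact support in `Ω × ℝ`. -/
theorem IsCc.eLpNorm_le {Ω : Set (E d)} {φ : E d × ℝ → ℝ} (h : IsCc (Ω ×ˢ univ) φ) (a : ℝ)
    (hd : 1 ≤ d) {R : ℝ} (hR0 : 0 ≤ R) (hR : ∀ x ∈ Ω, ‖x‖ ≤ R) :
    eLpNorm φ 2 (wMeas Ω a) ≤ ENNReal.ofReal (2 * R) * eLpNorm (gradXT φ) 2 (wMeas Ω a) := by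
  let i : Fin d := ⟨0, hd⟩
  set e : E d := EuclideanSpace.single i 1
  have hφc := h.1.continuous
  have hgc := continuous_gradXT h.1
  have slice : ∀ t, ∫⁻ x in Ω, ‖φ (x, t)‖ₑ ^ 2 ≤
      ENNReal.ofReal (4 * R ^ 2) * ∫⁻ x in Ω, ‖gradXT φ (x, t)‖ₑ ^ 2 := fun t => by
    let f : E d → ℝ := fun x => φ (x, t)
    have hf : ContDiff ℝ ∞ f := h.1.comp (contDiff_id.prodMk contDiff_const)
    have hfs : ∀ x, (x, t) ∉ tsupport φ → f x = 0 := fun x hx =>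
      image_eq_zero_of_notMem_tsupport (f := φ) hx
    have hc : HasCompactSupport f := by
      refine HasCompactSupport.intro (IsCompact.image h.2.1 continuous_fst) fun x hx => ?_
      exact hfs x fun hm => hx ⟨_, hm, rfl⟩
    have hfd : ∀ x, fderiv ℝ f x e = fderiv ℝ φ (x, t) (e, 0) := fun x => by
      have h1 := ((h.1.differentiable (by simp)) (x, t)).hasFDerivAt.comp x
        (hasFDerivAt_prodMk_left (𝕜 := ℝ) x t)
      have h2 : HasFDerivAt f _ x := h1
      rw [h2.fderiv]
      simp
    have hdc : Continuous fun x => fderiv ℝ f x e :=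
      (hf.continuous_fderiv (by simp)).clm_apply continuous_const
    have hds : HasCompactSupport fun x => fderiv ℝ f x e := hc.fderiv_apply ℝ e
    have hP := integral_sq_le hf hc i (R := R) fun x hx => by
      have hx' : x ∈ Ω := by
        by_contra hn
        exact hx (hfs x fun hm => hn (h.2.2 hm).1)
      exact (PiLp.norm_apply_le x i).trans (hR x hx')
    calc ∫⁻ x in Ω, ‖f x‖ₑ ^ 2 ≤ ∫⁻ x, ‖f x‖ₑ ^ 2 := setLIntegral_le_lintegral _ _
      _ ≤ ENNReal.ofReal (4 * R ^ 2) * ∫⁻ x, ‖fderiv ℝ f x e‖ₑ ^ 2 := by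
          rw [lintegral_enorm_sq_eq hf.continuous hc, lintegral_enorm_sq_eq hdc hds,
            ← ENNReal.ofReal_mul (by positivity)]
          exact ENNReal.ofReal_le_ofReal hP
      _ = ENNReal.ofReal (4 * R ^ 2) * ∫⁻ x in Ω, ‖fderiv ℝ f x e‖ₑ ^ 2 := by
          congr 1
          refine (setLIntegral_eq_of_support_subset fun x hx => ?_).symm
          by_contra hn
          refine hx ?_
          simp only [hfd]
          rw [fderiv_of_notMem_tsupport ℝ fun hm => hn (h.2.2 hm).1]
          simp
      _ ≤ _ := by
          gcongr with x
          rw [hfd]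
          exact enorm_le_iff_norm_le.2 (norm_fderiv_apply_le h.1 (x, t) (v := (e, 0))
            (by simp [e]))
  have hsq : eLpNorm φ 2 (wMeas Ω a) ^ 2 ≤
      (ENNReal.ofReal (2 * R) * eLpNorm (gradXT φ) 2 (wMeas Ω a)) ^ 2 := by
    rw [mul_pow, eLpNorm_two_sq, eLpNorm_two_sq, wMeas_eq_prod,
      lintegral_prod_symm _ (by fun_prop), lintegral_prod_symm _ (by fun_prop),
      ← ENNReal.ofReal_pow (by positivity), ← lintegral_const_mul]
    · refine lintegral_mono fun t => (slice t).trans_eq ?_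
      congr 2; ring
    · exact Measurable.lintegral_prod_left' (f := fun z => ‖gradXT φ z‖ₑ ^ 2) (by fun_prop)
  exact (ENNReal.pow_le_pow_left_iff two_ne_zero).1 hsq

section Green

variable {Ω : Set (E d)} {s : ℝ} {w w' : E d × ℝ → ℝ}

/-- The Poincaré inequality on the energy space. -/
theorem MemV.toReal_eLpNorm_le (h : MemV Ω s w) (hd : 1 ≤ d) (hΩ : IsOpen Ω) (hs0 : 0 < s)
    (hs1 : s < 1) {R : ℝ} (hR0 : 0 ≤ R) (hR : ∀ x ∈ Ω, ‖x‖ ≤ R) :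
    (eLpNorm w 2 (wMeas Ω (1 - 2 * s))).toReal ≤
      2 * R * (eLpNorm (grad Ω w) 2 (wMeas Ω (1 - 2 * s))).toReal := by
  obtain ⟨φ, hφ, hA⟩ := h.exists_isCc_approx hΩ hs0 hs1
  have t1 := tendsto_eLpNorm_toReal h.1 (fun n => (hA.1 n).memLp hs1) hA.2.2
  have t2 := (tendsto_eLpNorm_toReal (h.memLp_grad hΩ hs0 hs1)
    (fun n => (hA.1 n).memLp_gradXT hs1) (hA.tendsto_grad hΩ hs0 hs1 h.1)).const_mul (2 * R)
  refine le_of_tendsto_of_tendsto' t1 t2 fun n => ?_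
  have := (hφ n).eLpNorm_le (1 - 2 * s) hd hR0 hR
  have h2 := ENNReal.toReal_mono (ENNReal.mul_ne_top ENNReal.ofReal_ne_top
    ((hA.1 n).memLp_gradXT hs1).2.ne) this
  rwa [ENNReal.toReal_mul, ENNReal.toReal_ofReal (by positivity)] at h2

/-! ### The Green pairing -/

/-- The left-hand side `∫_Q (𝐲 ⊙ F + f div_{xt} 𝐲) dx dt` of the Green formula, as a bilinear
expression in the function `f` and a vector field `F` that stands for its gradient. -/
noncomputable def greenPairing (Ω : Set (E d)) (y : E d × ℝ → Vec d) (f : E d × ℝ → ℝ)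
    (F : E d × ℝ → Vec d) : ℝ :=
  ∫ z in halfCyl Ω, (⟪y z, F z⟫ + f z * divXT Ω y z)

variable {y : E d × ℝ → Vec d}

theorem MemYdiv.hasWeakDiv (hy : MemYdiv Ω s y) : HasWeakDiv Ω y (divXT Ω y) := by
  rw [divXT, dif_pos hy.2.1]
  exact hy.2.1.choose_spec

/-- The field `t^{2s-1} 𝐲`, square integrable with respect to `t^{1-2s} dx dt`. -/
theorem MemYdiv.memLp_smul (hy : MemYdiv Ω s y) (hΩ : IsOpen Ω) :
    MemLp (fun z => z.2 ^ (2 * s - 1) • y z) 2 (wMeas Ω (1 - 2 * s)) :=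
  memLp_rpow_smul hΩ (by ring) hy.1

theorem MemYdiv.memLp_smul_div (hy : MemYdiv Ω s y) (hΩ : IsOpen Ω) :
    MemLp (fun z => z.2 ^ (2 * s - 1) • divXT Ω y z) 2 (wMeas Ω (1 - 2 * s)) :=
  memLp_rpow_smul hΩ (by ring) hy.2.2

theorem setIntegral_inner_eq {H : Type*} [NormedAddCommGroup H] [InnerProductSpace ℝ H]
    (hΩ : IsOpen Ω) (s : ℝ) (y F : E d × ℝ → H) :
    ∫ z in halfCyl Ω, ⟪y z, F z⟫ =
      ∫ z, ⟪z.2 ^ (2 * s - 1) • y z, F z⟫ ∂(wMeas Ω (1 - 2 * s)) := by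
  rw [integral_wMeas hΩ]
  refine setIntegral_congr_fun (isOpen_halfCyl hΩ).measurableSet fun z hz => ?_
  have hz : 0 < z.2 := hz.2
  simp only [real_inner_smul_left, smul_eq_mul, ← mul_assoc]
  rw [← Real.rpow_add hz, show 1 - 2 * s + (2 * s - 1) = 0 by ring, Real.rpow_zero, one_mul]

theorem integrableOn_inner {H : Type*} [NormedAddCommGroup H] [InnerProductSpace ℝ H]
    (hΩ : IsOpen Ω) {y F : E d × ℝ → H} (hy : MemLp y 2 (wMeas Ω (2 * s - 1)))
    (hF : MemLp F 2 (wMeas Ω (1 - 2 * s))) :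
    IntegrableOn (fun z => ⟪y z, F z⟫) (halfCyl Ω) := by
  have h := (integrable_wMeas_iff hΩ _).1
    (integrable_inner_of_memLp (memLp_rpow_smul hΩ (a := 1 - 2 * s) (by ring) hy) hF)
  refine h.congr_fun (fun z hz => ?_) (isOpen_halfCyl hΩ).measurableSet
  have hz : 0 < z.2 := hz.2
  simp only [real_inner_smul_left, smul_eq_mul, ← mul_assoc]
  rw [← Real.rpow_add hz, show 1 - 2 * s + (2 * s - 1) = 0 by ring, Real.rpow_zero, one_mul]

theorem integrableOn_mul_divXT (hy : MemYdiv Ω s y) (hΩ : IsOpen Ω) {f : E d × ℝ → ℝ}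
    (hf : MemLp f 2 (wMeas Ω (1 - 2 * s))) :
    IntegrableOn (fun z => f z * divXT Ω y z) (halfCyl Ω) :=
  integrableOn_inner (H := ℝ) hΩ hy.2.2 hf

theorem greenPairing_eq_add (hy : MemYdiv Ω s y) (hΩ : IsOpen Ω) {f : E d × ℝ → ℝ}
    {F : E d × ℝ → Vec d} (hf : MemLp f 2 (wMeas Ω (1 - 2 * s)))
    (hF : MemLp F 2 (wMeas Ω (1 - 2 * s))) :
    greenPairing Ω y f F =
      (∫ z in halfCyl Ω, ⟪y z, F z⟫) + ∫ z in halfCyl Ω, f z * divXT Ω y z :=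
  integral_add (integrableOn_inner hΩ hy.1 hF) (integrableOn_mul_divXT hy hΩ hf)

theorem greenPairing_eq (hy : MemYdiv Ω s y) (hΩ : IsOpen Ω) {f : E d × ℝ → ℝ}
    {F : E d × ℝ → Vec d} (hf : MemLp f 2 (wMeas Ω (1 - 2 * s)))
    (hF : MemLp F 2 (wMeas Ω (1 - 2 * s))) :
    greenPairing Ω y f F =
      (∫ z, ⟪z.2 ^ (2 * s - 1) • y z, F z⟫ ∂(wMeas Ω (1 - 2 * s))) +
      ∫ z, ⟪z.2 ^ (2 * s - 1) • divXT Ω y z, f z⟫ ∂(wMeas Ω (1 - 2 * s)) := by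
  rw [greenPairing_eq_add hy hΩ hf hF, ← setIntegral_inner_eq hΩ s, ← setIntegral_inner_eq hΩ s]
  rfl

theorem greenPairing_add (hy : MemYdiv Ω s y) (hΩ : IsOpen Ω) {f f' : E d × ℝ → ℝ}
    {F F' : E d × ℝ → Vec d} (hf : MemLp f 2 (wMeas Ω (1 - 2 * s)))
    (hF : MemLp F 2 (wMeas Ω (1 - 2 * s))) (hf' : MemLp f' 2 (wMeas Ω (1 - 2 * s)))
    (hF' : MemLp F' 2 (wMeas Ω (1 - 2 * s))) :
    greenPairing Ω y (f + f') (F + F') = greenPairing Ω y f F + greenPairing Ω y f' F' := by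
  refine Eq.trans ?_ (integral_add
    ((integrableOn_inner hΩ hy.1 hF).add (integrableOn_mul_divXT hy hΩ hf))
    ((integrableOn_inner hΩ hy.1 hF').add (integrableOn_mul_divXT hy hΩ hf')))
  unfold greenPairing
  congr 1
  ext z
  simp only [Pi.add_apply, inner_add_right]
  ring

theorem greenPairing_smul (c : ℝ) (f : E d × ℝ → ℝ) (F : E d × ℝ → Vec d) :
    greenPairing Ω y (c • f) (c • F) = c * greenPairing Ω y f F := by
  unfold greenPairing
  rw [← integral_const_mul]
  congr 1
  ext z
  simp only [Pi.smul_apply, inner_smul_right, smul_eq_mul]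
  ring

theorem greenPairing_congr (hΩ : IsOpen Ω) {a : ℝ} {f : E d × ℝ → ℝ} {F F' : E d × ℝ → Vec d}
    (h : F =ᵐ[wMeas Ω a] F') : greenPairing Ω y f F = greenPairing Ω y f F' := by
  refine integral_congr_ae ?_
  filter_upwards [(ae_wMeas_iff hΩ a).1 h] with z hz
  rw [hz]

/-- If `f` and `F` vanish outside of a set `S`, only the norms over `S` matter. -/
theorem abs_greenPairing_le_of_subset (hy : MemYdiv Ω s y) (hΩ : IsOpen Ω) {f : E d × ℝ → ℝ}
    {F : E d × ℝ → Vec d} (hf : MemLp f 2 (wMeas Ω (1 - 2 * s)))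
    (hF : MemLp F 2 (wMeas Ω (1 - 2 * s))) {S : Set (E d × ℝ)}
    (h0 : ∀ z ∉ S, f z = 0) (h1 : ∀ z ∉ S, F z = 0) :
    |greenPairing Ω y f F| ≤
      (eLpNorm (fun z => z.2 ^ (2 * s - 1) • y z) 2 ((wMeas Ω (1 - 2 * s)).restrict S)).toReal *
        (eLpNorm F 2 ((wMeas Ω (1 - 2 * s)).restrict S)).toReal +
      (eLpNorm (fun z => z.2 ^ (2 * s - 1) • divXT Ω y z) 2
          ((wMeas Ω (1 - 2 * s)).restrict S)).toReal *
        (eLpNorm f 2 ((wMeas Ω (1 - 2 * s)).restrict S)).toReal := by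
  have e1 := setIntegral_eq_integral_of_forall_compl_eq_zero (μ := wMeas Ω (1 - 2 * s)) (s := S)
    (f := fun z => ⟪z.2 ^ (2 * s - 1) • y z, F z⟫) fun z hz => by rw [h1 z hz, inner_zero_right]
  have e2 := setIntegral_eq_integral_of_forall_compl_eq_zero (μ := wMeas Ω (1 - 2 * s)) (s := S)
    (f := fun z => ⟪z.2 ^ (2 * s - 1) • divXT Ω y z, f z⟫) fun z hz => by
      rw [h0 z hz, inner_zero_right]
  rw [greenPairing_eq hy hΩ hf hF, ← e1, ← e2]
  exact (abs_add_le _ _).trans (add_le_add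
    (abs_integral_inner_le ((hy.memLp_smul hΩ).restrict S) (hF.restrict S))
    (abs_integral_inner_le ((hy.memLp_smul_div hΩ).restrict S) (hf.restrict S)))

theorem abs_greenPairing_le (hy : MemYdiv Ω s y) (hΩ : IsOpen Ω) {f : E d × ℝ → ℝ}
    {F : E d × ℝ → Vec d} (hf : MemLp f 2 (wMeas Ω (1 - 2 * s)))
    (hF : MemLp F 2 (wMeas Ω (1 - 2 * s))) :
    |greenPairing Ω y f F| ≤
      (eLpNorm (fun z => z.2 ^ (2 * s - 1) • y z) 2 (wMeas Ω (1 - 2 * s))).toReal *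
        (eLpNorm F 2 (wMeas Ω (1 - 2 * s))).toReal +
      (eLpNorm (fun z => z.2 ^ (2 * s - 1) • divXT Ω y z) 2 (wMeas Ω (1 - 2 * s))).toReal *
        (eLpNorm f 2 (wMeas Ω (1 - 2 * s))).toReal := by
  simpa using abs_greenPairing_le_of_subset hy hΩ hf hF (S := univ) (by simp) (by simp)

theorem tendsto_greenPairing (hy : MemYdiv Ω s y) (hΩ : IsOpen Ω) (hs0 : 0 < s) (hs1 : s < 1)
    (hw : MemV Ω s w) {φ : ℕ → E d × ℝ → ℝ} (h : Approx Ω s φ w) :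
    Tendsto (fun n => greenPairing Ω y (φ n) (gradXT (φ n))) atTop
      (𝓝 (greenPairing Ω y w (grad Ω w))) := by
  have m1 := fun n => (h.1 n).memLp hs1
  have m2 := fun n => (h.1 n).memLp_gradXT hs1
  have hg := hw.memLp_grad hΩ hs0 hs1
  rw [greenPairing_eq hy hΩ hw.1 hg]
  simp_rw [fun n => greenPairing_eq hy hΩ (m1 n) (m2 n)]
  exact (tendsto_integral_inner (hy.memLp_smul hΩ) hg m2 (h.tendsto_grad hΩ hs0 hs1 hw.1)).add
    (tendsto_integral_inner (hy.memLp_smul_div hΩ) hw.1 m1 h.2.2)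

theorem greenPairing_eq_zero_of_isCc (hy : MemYdiv Ω s y) (hΩ : IsOpen Ω) (hs1 : s < 1)
    {ψ : E d × ℝ → ℝ} (h : IsCc (halfCyl Ω) ψ) : greenPairing Ω y ψ (gradXT ψ) = 0 := by
  rw [greenPairing_eq_add hy hΩ (memLp_of_continuous Ω (by linarith) h.1.continuous h.2.1)
    (memLp_gradXT Ω (by linarith) h.1 h.2.1), hy.hasWeakDiv.2.2 ψ h]
  simp_rw [mul_comm]
  exact neg_add_cancel _

/-! ### Functions with zero trace -/

/-- Smooth cut-off functions near `t = 0`, with the natural scaling of the derivative. -/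
theorem exists_cutoff : ∃ C : ℝ, 0 ≤ C ∧ ∀ R : ℝ, 0 < R → ∃ θ : ℝ → ℝ, ContDiff ℝ ∞ θ ∧
    (∀ t, t ≤ R / 4 → θ t = 1) ∧ (∀ t, R / 2 ≤ t → θ t = 0) ∧ (∀ t, |θ t| ≤ 1) ∧
    ∀ t, |deriv θ t| ≤ C / R := by
  have hT : ContDiff ℝ ∞ Real.smoothTransition := Real.smoothTransition.contDiff
  have hc : Continuous (deriv Real.smoothTransition) := hT.continuous_deriv (by simp)
  obtain ⟨M, hM⟩ := (isCompact_Icc (a := (0 : ℝ)) (b := 1)).exists_bound_of_continuousOn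
    hc.continuousOn
  have hM0 : 0 ≤ M := (norm_nonneg _).trans (hM 0 (by simp))
  have hMall : ∀ u, |deriv Real.smoothTransition u| ≤ M := fun u => by
    rcases lt_or_ge u 0 with h0 | h0
    · have : Real.smoothTransition =ᶠ[𝓝 u] fun _ => 0 :=
        (eventually_lt_nhds h0).mono fun x hx => Real.smoothTransition.zero_of_nonpos hx.le
      rw [this.deriv_eq, deriv_const, abs_zero]; exact hM0
    · rcases le_or_gt u 1 with h1 | h1
      · exact hM u ⟨h0, h1⟩
      · have : Real.smoothTransition =ᶠ[𝓝 u] fun _ => 1 :=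
          (eventually_gt_nhds h1).mono fun x hx => Real.smoothTransition.one_of_one_le hx.le
        rw [this.deriv_eq, deriv_const, abs_zero]; exact hM0
  refine ⟨4 * M, by positivity, fun R hR => ?_⟩
  have hl : ∀ t : ℝ, HasDerivAt (fun t => 4 / R * t - 1) (4 / R) t := fun t => by
    simpa using ((hasDerivAt_id t).const_mul (4 / R)).sub_const 1
  refine ⟨fun t => 1 - Real.smoothTransition (4 / R * t - 1), ?_, fun t ht => ?_, fun t ht => ?_,
    fun t => ?_, fun t => ?_⟩
  · exact contDiff_const.sub (hT.comp ((contDiff_const.mul contDiff_id).sub contDiff_const))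
  · simp only
    rw [Real.smoothTransition.zero_of_nonpos, sub_zero]
    have : 4 / R * t ≤ 4 / R * (R / 4) := by gcongr
    rw [show 4 / R * (R / 4) = 1 by field_simp] at this
    linarith
  · simp only
    rw [Real.smoothTransition.one_of_one_le, sub_self]
    have : 4 / R * (R / 2) ≤ 4 / R * t := by gcongr
    rw [show 4 / R * (R / 2) = 2 by field_simp; norm_num] at this
    linarith
  · have h0 := Real.smoothTransition.nonneg (4 / R * t - 1)
    have h1 := Real.smoothTransition.le_one (4 / R * t - 1)
    exact abs_le.2 ⟨by linarith, by linarith⟩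
  · have h := ((hT.differentiable (by simp) _).hasDerivAt.comp t (hl t)).const_sub 1
    have h' : HasDerivAt (fun t => 1 - Real.smoothTransition (4 / R * t - 1)) _ t := h
    rw [h'.deriv, abs_neg, abs_mul, abs_of_pos (show 0 < 4 / R by positivity),
      show 4 * M / R = M * (4 / R) by ring]
    gcongr
    exact hMall _

theorem norm_gradXT_snd_le (z : E d × ℝ) :
    ‖gradXT (Prod.snd : E d × ℝ → ℝ) z‖ ≤ 1 := by
  set G := gradXT (Prod.snd : E d × ℝ → ℝ) z with hG
  have h1 : ⟪G, G⟫ = G.snd := by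
    conv_lhs => rw [hG]
    rw [← hG, hG, inner_gradXT contDiff_snd, fderiv_snd]
    rfl
  rw [real_inner_self_eq_norm_sq] at h1
  have h2 : G.snd ≤ ‖G‖ := (le_abs_self _).trans (WithLp.norm_snd_le (p := 2) (x := G))
  nlinarith [norm_nonneg G]

/-- Only the part of a function near `t = 0` contributes to the Green pairing. The point of the
estimate is that `C` does not depend on the width `R` of the strip. -/
theorem abs_greenPairing_le_strip : ∃ C : ℝ, 0 ≤ C ∧ ∀ {d : ℕ} {Ω : Set (E d)} {s : ℝ}
    {y : E d × ℝ → Vec d} {φ : E d × ℝ → ℝ} {R : ℝ}, MemYdiv Ω s y → IsOpen Ω → s < 1 →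
    IsCc (Ω ×ˢ univ) φ → 0 < R →
    |greenPairing Ω y φ (gradXT φ)| ≤
      (eLpNorm (fun z => z.2 ^ (2 * s - 1) • y z) 2
          ((wMeas Ω (1 - 2 * s)).restrict (univ ×ˢ Iio R))).toReal *
        ((eLpNorm (gradXT φ) 2 (wMeas Ω (1 - 2 * s))).toReal + C / R *
          (eLpNorm φ 2 ((wMeas Ω (1 - 2 * s)).restrict (univ ×ˢ Iio R))).toReal) +
      (eLpNorm (fun z => z.2 ^ (2 * s - 1) • divXT Ω y z) 2
          ((wMeas Ω (1 - 2 * s)).restrict (univ ×ˢ Iio R))).toReal *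
        (eLpNorm φ 2 (wMeas Ω (1 - 2 * s))).toReal := by
  obtain ⟨C, hC, hcut⟩ := exists_cutoff
  refine ⟨C, hC, fun {d Ω s y φ R} hy hΩ hs1 h hR => ?_⟩
  obtain ⟨θ, hθ, hθ1, hθ0, hθb, hθd⟩ := hcut R hR
  set μ := wMeas Ω (1 - 2 * s)
  set S : Set (E d × ℝ) := univ ×ˢ Iio R
  have hsnd : ContDiff ℝ ∞ (Prod.snd : E d × ℝ → ℝ) := contDiff_snd
  have hθs : ContDiff ℝ ∞ (θ ∘ Prod.snd : E d × ℝ → ℝ) := hθ.comp hsnd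
  -- `φ - φ₁` has compact support in the half-cylinder, where the weak divergence applies
  set φ₁ := (θ ∘ Prod.snd) * φ with hφ₁
  have h1 : IsCc (Ω ×ˢ univ) φ₁ :=
    ⟨hθs.mul h.1, h.2.1.mul_left, (tsupport_mul_subset_right).trans h.2.2⟩
  have T := h.isTest hΩ
  have T1 := h1.isTest hΩ
  have h2 : IsCc (halfCyl Ω) (φ - φ₁) := by
    have hsub : tsupport (φ - φ₁) ⊆ tsupport φ ∩ {z | R / 4 ≤ z.2} := by
      refine closure_minimal (fun z hz => ?_)
        ((isClosed_tsupport _).inter (isClosed_le continuous_const continuous_snd))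
      have e : (φ - φ₁) z = (1 - θ z.2) * φ z := by
        simp only [hφ₁, Pi.sub_apply, Pi.mul_apply, Function.comp_apply]; ring
      rw [Function.mem_support, e] at hz
      refine ⟨subset_tsupport _ (right_ne_zero_of_mul hz), ?_⟩
      by_contra hn
      exact left_ne_zero_of_mul hz (by rw [hθ1 _ (not_le.1 hn).le, sub_self])
    refine ⟨h.1.sub h1.1, h.2.1.of_isClosed_subset (isClosed_tsupport _)
      (hsub.trans inter_subset_left), fun z hz => ⟨(h.2.2 (hsub hz).1).1, ?_⟩⟩
    have : R / 4 ≤ z.2 := (hsub hz).2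
    exact lt_of_lt_of_le (by positivity) this
  have hmem := T.memLp (s := s) hs1
  have hmemg := T.memLp_gradXT (s := s) hs1
  have hmem1 := T1.memLp (s := s) hs1
  have hmemg1 := T1.memLp_gradXT (s := s) hs1
  have e0 : greenPairing Ω y φ (gradXT φ) = greenPairing Ω y φ₁ (gradXT φ₁) := by
    have e1 := greenPairing_add hy hΩ hmem1 hmemg1 (hmem.sub hmem1) (hmemg.sub hmemg1)
    rw [← gradXT_sub h.1 h1.1, greenPairing_eq_zero_of_isCc hy hΩ hs1 h2, gradXT_sub h.1 h1.1,
      add_sub_cancel, add_sub_cancel, add_zero] at e1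
    exact e1
  have hz0 : ∀ z ∉ S, φ₁ =ᶠ[𝓝 z] 0 := fun z hz => by
    have hz' : R / 2 < z.2 := by
      have : R ≤ z.2 := by
        by_contra hn; exact hz ⟨mem_univ _, not_le.1 hn⟩
      linarith
    have ho : IsOpen {z : E d × ℝ | R / 2 < z.2} := isOpen_lt continuous_const continuous_snd
    filter_upwards [ho.mem_nhds hz'] with x hx
    simp only [hφ₁, Pi.mul_apply, Function.comp_apply, Pi.zero_apply]
    rw [hθ0 _ (le_of_lt hx), zero_mul]
  have hgr : ∀ z, ‖gradXT φ₁ z‖ ≤ ‖gradXT φ z‖ + ‖C / R * φ z‖ := fun z => by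
    rw [hφ₁, gradXT_mul hθs h.1, gradXT_comp hsnd hθ]
    refine (norm_add_le _ _).trans (add_le_add ?_ ?_)
    · rw [norm_smul]
      exact mul_le_of_le_one_left (norm_nonneg _) (hθb _)
    · rw [norm_smul, norm_smul, norm_mul, Real.norm_eq_abs (C / R),
        abs_of_nonneg (by positivity : 0 ≤ C / R), mul_comm]
      gcongr
      calc ‖deriv θ z.2‖ * ‖gradXT Prod.snd z‖ ≤ C / R * 1 := by
            gcongr
            · exact hθd _
            · exact norm_gradXT_snd_le z
        _ = C / R := mul_one _
  have b1 : (eLpNorm (gradXT φ₁) 2 (μ.restrict S)).toReal ≤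
      (eLpNorm (gradXT φ) 2 μ).toReal + C / R * (eLpNorm φ 2 (μ.restrict S)).toReal := by
    have n1 : eLpNorm (gradXT φ₁) 2 (μ.restrict S) ≤
        eLpNorm (gradXT φ) 2 μ + ENNReal.ofReal (C / R) * eLpNorm φ 2 (μ.restrict S) := by
      have c1 : eLpNorm (fun z => C / R * φ z) 2 (μ.restrict S) =
          ENNReal.ofReal (C / R) * eLpNorm φ 2 (μ.restrict S) := by
        have := eLpNorm_const_smul (C / R) φ 2 (μ.restrict S)
        rw [Real.enorm_of_nonneg (by positivity)] at this
        exact this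
      rw [← c1]
      refine (eLpNorm_mono_real (g := fun z => ‖gradXT φ z‖ + ‖C / R * φ z‖) hgr).trans ?_
      refine (eLpNorm_add_le (hmemg.restrict S).norm.1 ((hmem.restrict S).const_mul _).norm.1
        (by norm_num)).trans ?_
      rw [eLpNorm_norm, eLpNorm_norm]
      gcongr
      exact Measure.restrict_le_self
    have n2 := ENNReal.toReal_mono (ENNReal.add_ne_top.2 ⟨hmemg.2.ne,
      ENNReal.mul_ne_top ENNReal.ofReal_ne_top (hmem.restrict S).2.ne⟩) n1
    rwa [ENNReal.toReal_add hmemg.2.ne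
      (ENNReal.mul_ne_top ENNReal.ofReal_ne_top (hmem.restrict S).2.ne), ENNReal.toReal_mul,
      ENNReal.toReal_ofReal (by positivity)] at n2
  have b2 : (eLpNorm φ₁ 2 (μ.restrict S)).toReal ≤ (eLpNorm φ 2 μ).toReal := by
    refine ENNReal.toReal_mono hmem.2.ne ?_
    refine (eLpNorm_mono fun z => ?_).trans (eLpNorm_mono_measure _ Measure.restrict_le_self)
    rw [hφ₁, Pi.mul_apply, norm_mul]
    exact mul_le_of_le_one_left (norm_nonneg _) (hθb _)
  rw [e0]
  refine (abs_greenPairing_le_of_subset hy hΩ hmem1 hmemg1 (S := S)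
    (fun z hz => (hz0 z hz).self_of_nhds) (fun z hz => gradXT_eq_zero h1.1 ?_)).trans ?_
  · rw [(hz0 z hz).fderiv_eq]; exact fderiv_const_apply 0
  · gcongr

/-- The `L²` norm over the strip `0 < t < 1 / (n + 1)` tends to `0`. -/
theorem tendsto_eLpNorm_strip {H : Type*} [NormedAddCommGroup H] (hΩ : IsOpen Ω) {a : ℝ}
    {F : E d × ℝ → H} (hF : MemLp F 2 (wMeas Ω a)) :
    Tendsto (fun n : ℕ => (eLpNorm F 2
      ((wMeas Ω a).restrict (univ ×ˢ Iio ((n : ℝ) + 1)⁻¹))).toReal) atTop (𝓝 0) := by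
  have hm : ∀ n : ℕ, MeasurableSet (univ ×ˢ Iio ((n : ℝ) + 1)⁻¹ : Set (E d × ℝ)) := fun n =>
    MeasurableSet.univ.prod measurableSet_Iio
  simp_rw [fun n => (eLpNorm_indicator_eq_eLpNorm_restrict (f := F) (p := 2) (μ := wMeas Ω a)
    (hm n)).symm]
  have t := tendsto_eLpNorm_two_of_dominated
    (F := fun n => (univ ×ˢ Iio ((n : ℝ) + 1)⁻¹ : Set (E d × ℝ)).indicator F)
    (fun n => (hF.indicator (hm n)).1) hF.norm (fun n => ae_of_all _ fun z => ?_)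
    (ae_wMeas_of_forall hΩ a fun z hz => ?_)
  · exact (ENNReal.tendsto_toReal ENNReal.zero_ne_top).comp t
  · rw [norm_norm]; exact norm_indicator_le_norm_self _ _
  · have hz : 0 < z.2 := hz.2
    have t1 := tendsto_one_div_add_atTop_nhds_zero_nat (𝕜 := ℝ)
    refine tendsto_const_nhds.congr' ?_
    filter_upwards [t1.eventually_lt_const hz] with n hn
    rw [indicator_of_notMem]
    rintro ⟨-, h⟩
    rw [mem_Iio, ← one_div] at h
    exact absurd h (not_lt.2 hn.le)

/-- Hardy's inequality for functions with zero trace. -/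
theorem toReal_eLpNorm_strip_le (hw : MemV Ω s w) (hw0 : HasTrace Ω s w 0) (hΩ : IsOpen Ω)
    (hs0 : 0 < s) (hs1 : s < 1) {R : ℝ} (hR : 0 < R) :
    (eLpNorm w 2 ((wMeas Ω (1 - 2 * s)).restrict (univ ×ˢ Iio R))).toReal ≤
      √s⁻¹ * R * (eLpNorm (grad Ω w) 2 (wMeas Ω (1 - 2 * s))).toReal := by
  obtain ⟨φ, hφ, hA⟩ := hw.exists_isCc_approx hΩ hs0 hs1
  set μ := wMeas Ω (1 - 2 * s)
  set S : Set (E d × ℝ) := univ ×ˢ Iio R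
  have hg := hw.memLp_grad hΩ hs0 hs1
  have t0 := hw0.tendsto hA hΩ hs0 hs1
  simp only [Pi.zero_apply, sub_zero] at t0
  have t1 : Tendsto (fun n => (eLpNorm (φ n) 2 (μ.restrict S)).toReal) atTop
      (𝓝 (eLpNorm w 2 (μ.restrict S)).toReal) := by
    refine tendsto_eLpNorm_toReal (hw.1.restrict S) (fun n => ((hA.1 n).memLp hs1).restrict S) ?_
    exact tendsto_of_tendsto_of_tendsto_of_le_of_le tendsto_const_nhds hA.2.2
      (fun _ => zero_le) (fun n => eLpNorm_mono_measure _ Measure.restrict_le_self)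
  have t2 := tendsto_eLpNorm_toReal hg (fun n => (hA.1 n).memLp_gradXT hs1)
    (hA.tendsto_grad hΩ hs0 hs1 hw.1)
  have t3 := (ENNReal.tendsto_toReal ENNReal.zero_ne_top).comp t0
  simp only [Function.comp_def, ENNReal.toReal_zero] at t3
  have hle := le_of_tendsto_of_tendsto' (t1.pow 2)
    (((t3.pow 2).const_mul (2 * wLine (1 - 2 * s) (Iio R)).toReal).add
      ((t2.pow 2).const_mul (2 * (R ^ 2 / (1 - (1 - 2 * s)))))) fun n => ?_
  · have hpos : 0 ≤ 1 - (1 - 2 * s) := by linarith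
    refine le_of_sq_le_sq ?_ (by positivity)
    refine hle.trans_eq ?_
    rw [mul_pow, mul_pow, Real.sq_sqrt (by positivity)]
    field_simp
    ring
  · have hH := eLpNorm_strip_sq_le (a := 1 - 2 * s) (by linarith) Ω (hφ n).1 hR
    have f1 : 2 * wLine (1 - 2 * s) (Iio R) ≠ ⊤ :=
      ENNReal.mul_ne_top (by simp) (wLine_Iio_lt_top (by linarith) R).ne
    have f2 := (hA.1 n).memLp_zero.2.ne
    have f3 := ((hA.1 n).memLp_gradXT hs1).2.ne
    have f4 : 2 * ENNReal.ofReal (R ^ 2 / (1 - (1 - 2 * s))) ≠ ⊤ :=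
      ENNReal.mul_ne_top (by simp) ENNReal.ofReal_ne_top
    have f5 := ENNReal.mul_ne_top f1 (ENNReal.pow_ne_top f2 (n := 2))
    have f6 := ENNReal.mul_ne_top f4 (ENNReal.pow_ne_top f3 (n := 2))
    have hH' := ENNReal.toReal_mono (ENNReal.add_ne_top.2 ⟨f5, f6⟩) hH
    rw [ENNReal.toReal_add f5 f6] at hH'
    simp only [ENNReal.toReal_mul, ENNReal.toReal_pow, ENNReal.toReal_ofNat] at hH' ⊢
    rwa [ENNReal.toReal_ofReal (div_nonneg (by positivity) (by linarith))] at hH'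

/-- The Green pairing vanishes on the functions with zero trace. -/
theorem greenPairing_eq_zero (hy : MemYdiv Ω s y) (hw0 : HasTrace Ω s w 0) (hΩ : IsOpen Ω)
    (hs0 : 0 < s) (hs1 : s < 1) : greenPairing Ω y w (grad Ω w) = 0 := by
  have hw := hw0.memV
  obtain ⟨C, hC, hstrip⟩ := abs_greenPairing_le_strip
  obtain ⟨φ, hφ, hA⟩ := hw.exists_isCc_approx hΩ hs0 hs1
  set μ := wMeas Ω (1 - 2 * s) with hμ
  have hg := hw.memLp_grad hΩ hs0 hs1
  have t1 := tendsto_eLpNorm_toReal hw.1 (fun n => (hA.1 n).memLp hs1) hA.2.2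
  have t2 := tendsto_eLpNorm_toReal hg (fun n => (hA.1 n).memLp_gradXT hs1)
    (hA.tendsto_grad hΩ hs0 hs1 hw.1)
  have hb : ∀ R : ℝ, 0 < R → |greenPairing Ω y w (grad Ω w)| ≤
      (eLpNorm (fun z => z.2 ^ (2 * s - 1) • y z) 2 (μ.restrict (univ ×ˢ Iio R))).toReal *
        ((1 + C * √s⁻¹) * (eLpNorm (grad Ω w) 2 μ).toReal) +
      (eLpNorm (fun z => z.2 ^ (2 * s - 1) • divXT Ω y z) 2
        (μ.restrict (univ ×ˢ Iio R))).toReal * (eLpNorm w 2 μ).toReal := fun R hR => by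
    set S : Set (E d × ℝ) := univ ×ˢ Iio R with hS
    have t3 : Tendsto (fun n => (eLpNorm (φ n) 2 (μ.restrict S)).toReal) atTop
        (𝓝 (eLpNorm w 2 (μ.restrict S)).toReal) := by
      refine tendsto_eLpNorm_toReal (hw.1.restrict S)
        (fun n => ((hA.1 n).memLp hs1).restrict S) ?_
      exact tendsto_of_tendsto_of_tendsto_of_le_of_le tendsto_const_nhds hA.2.2
        (fun _ => zero_le) (fun n => eLpNorm_mono_measure _ Measure.restrict_le_self)
    have hl := le_of_tendsto_of_tendsto' (tendsto_greenPairing hy hΩ hs0 hs1 hw hA).abs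
      (((t2.add (t3.const_mul (C / R))).const_mul _).add (t1.const_mul _))
      fun n => hstrip hy hΩ hs1 (hφ n) hR
    refine hl.trans ?_
    gcongr
    have hH := toReal_eLpNorm_strip_le hw hw0 hΩ hs0 hs1 hR
    calc (eLpNorm (grad Ω w) 2 μ).toReal + C / R * (eLpNorm w 2 (μ.restrict S)).toReal
        ≤ (eLpNorm (grad Ω w) 2 μ).toReal +
          C / R * (√s⁻¹ * R * (eLpNorm (grad Ω w) 2 μ).toReal) := by gcongr
      _ = _ := by field_simp
  have l1 := (tendsto_eLpNorm_strip hΩ (hy.memLp_smul hΩ)).mul_const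
    ((1 + C * √s⁻¹) * (eLpNorm (grad Ω w) 2 μ).toReal)
  have l2 := (tendsto_eLpNorm_strip hΩ (hy.memLp_smul_div hΩ)).mul_const (eLpNorm w 2 μ).toReal
  have l3 := l1.add l2
  rw [zero_mul, zero_mul, add_zero] at l3
  exact abs_eq_zero.1 (le_antisymm (ge_of_tendsto' l3 fun n => hb _ (by positivity))
    (abs_nonneg _))

/-! ### The boundary value of the last component of a flux -/

theorem MemV.greenPairing_add (hy : MemYdiv Ω s y) (h : MemV Ω s w) (k : MemV Ω s w')
    (hΩ : IsOpen Ω) (hs0 : 0 < s) (hs1 : s < 1) :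
    greenPairing Ω y (w + w') (grad Ω (w + w')) =
      greenPairing Ω y w (grad Ω w) + greenPairing Ω y w' (grad Ω w') := by
  rw [greenPairing_congr hΩ (h.grad_add k hΩ hs0 hs1)]
  exact StingaTorrea.greenPairing_add hy hΩ h.1 (h.memLp_grad hΩ hs0 hs1) k.1
    (k.memLp_grad hΩ hs0 hs1)

theorem MemV.greenPairing_smul (h : MemV Ω s w) (c : ℝ) (hΩ : IsOpen Ω) (hs0 : 0 < s)
    (hs1 : s < 1) :
    greenPairing Ω y (c • w) (grad Ω (c • w)) = c * greenPairing Ω y w (grad Ω w) := by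
  rw [greenPairing_congr hΩ (h.grad_smul c hΩ hs0 hs1)]
  exact StingaTorrea.greenPairing_smul c w _

/-- The Green pairing with an element of the energy space depends only on its trace. -/
theorem greenPairing_eq_of_tr_eq (hy : MemYdiv Ω s y) (h : MemV Ω s w) (k : MemV Ω s w')
    (hΩ : IsOpen Ω) (hs0 : 0 < s) (hs1 : s < 1) (e : tr Ω s w = tr Ω s w') :
    greenPairing Ω y w (grad Ω w) = greenPairing Ω y w' (grad Ω w') := by
  have hd : MemV Ω s (w - w') := h.sub k hΩ hs0 hs1
  have h0 : HasTrace Ω s (w - w') 0 := by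
    refine (hd.hasTrace_tr hΩ hs0 hs1).congr ?_
    rw [h.tr_sub k hΩ hs0 hs1, e, sub_self]
    exact Lp.coeFn_zero _ _ _
  have h1 := hd.greenPairing_add hy k hΩ hs0 hs1
  rwa [sub_add_cancel, greenPairing_eq_zero hy h0 hΩ hs0 hs1, zero_add] at h1

/-- The boundary value of a flux exists: it is defined on the trace of `w ∈ 𝓥` by the Green formula
for `w`. -/
theorem exists_green (hd : 1 ≤ d) (hΩ : IsOpen Ω) (hΩb : Bornology.IsBounded Ω) (hs0 : 0 < s)
    (hs1 : s < 1) (hy : MemYdiv Ω s y) :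
    ∃ N : traceDual Ω s, ∀ w, MemV Ω s w →
      greenPairing Ω y w (grad Ω w) = - N.1 (tr Ω s w) := by
  choose ext hext htr using fun v : traceSpace Ω s => exists_tr_eq v hΩ hs0 hs1
  let L : traceSpace Ω s →ₗ[ℝ] ℝ :=
    { toFun := fun v => - greenPairing Ω y (ext v) (grad Ω (ext v))
      map_add' := fun v v' => by
        rw [← neg_add, ← (hext v).greenPairing_add hy (hext v') hΩ hs0 hs1,
          greenPairing_eq_of_tr_eq hy (hext (v + v')) ((hext v).add (hext v') hΩ hs0 hs1)
            hΩ hs0 hs1]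
        rw [(hext v).tr_add (hext v') hΩ hs0 hs1, htr, htr, htr]
      map_smul' := fun c v => by
        rw [RingHom.id_apply, smul_eq_mul, mul_neg, ← (hext v).greenPairing_smul c hΩ hs0 hs1,
          greenPairing_eq_of_tr_eq hy (hext (c • v)) ((hext v).smul c hΩ hs0 hs1) hΩ hs0 hs1]
        rw [(hext v).tr_smul c hΩ hs0 hs1, htr, htr] }
  have hL : ∀ w, MemV Ω s w → greenPairing Ω y w (grad Ω w) = - L (tr Ω s w) := fun w hw => by
    simp only [L, LinearMap.coe_mk, AddHom.coe_mk, neg_neg]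
    exact greenPairing_eq_of_tr_eq hy hw (hext _) hΩ hs0 hs1 (htr _).symm
  obtain ⟨R, hR⟩ := hΩb.exists_norm_le
  have hR' : ∀ x ∈ Ω, ‖x‖ ≤ max R 0 := fun x hx => (hR x hx).trans (le_max_left _ _)
  refine ⟨⟨L, ?_⟩, hL⟩
  refine ⟨(eLpNorm (fun z => z.2 ^ (2 * s - 1) • y z) 2 (wMeas Ω (1 - 2 * s))).toReal +
    (eLpNorm (fun z => z.2 ^ (2 * s - 1) • divXT Ω y z) 2 (wMeas Ω (1 - 2 * s))).toReal *
      (2 * max R 0), fun w hw => ?_⟩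
  rw [← abs_neg, ← hL w hw, hw.sqrt_normtSq hΩ hs0 hs1, add_mul, mul_assoc]
  refine (abs_greenPairing_le hy hΩ hw.1 (hw.memLp_grad hΩ hs0 hs1)).trans ?_
  gcongr
  exact hw.toReal_eLpNorm_le hd hΩ hs0 hs1 (le_max_right _ _) hR'

theorem isNormalTrace_of_green (hΩ : IsOpen Ω) (hs0 : 0 < s) (hs1 : s < 1) {N : traceDual Ω s}
    (h : ∀ w, MemV Ω s w → greenPairing Ω y w (grad Ω w) = - N.1 (tr Ω s w)) :
    IsNormalTrace Ω s y N := fun φ hφ => by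
  have T := hφ.isTest hΩ
  rw [← h φ (T.memV hs1), greenPairing_congr hΩ (T.grad_ae_eq hΩ hs0 hs1)]
  rfl

/-- An element of the dual of the trace space is continuous along approximating sequences. -/
theorem tendsto_traceDual (N : traceDual Ω s) (hw : MemV Ω s w) (hΩ : IsOpen Ω) (hs0 : 0 < s)
    (hs1 : s < 1) {φ : ℕ → E d × ℝ → ℝ} (h : Approx Ω s φ w) :
    Tendsto (fun n => N.1 (tr Ω s (φ n))) atTop (𝓝 (N.1 (tr Ω s w))) := by
  obtain ⟨C, hC⟩ := N.2
  rw [tendsto_iff_norm_sub_tendsto_zero]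
  have t := ((ENNReal.tendsto_toReal ENNReal.zero_ne_top).comp
    (h.tendsto_grad hΩ hs0 hs1 hw.1)).const_mul C
  rw [ENNReal.toReal_zero, mul_zero] at t
  refine squeeze_zero (fun _ => norm_nonneg _) (fun n => ?_) t
  have T := h.1 n
  have hV := T.memV hs1
  have hsub := hV.sub hw hΩ hs0 hs1
  rw [← map_sub, ← hV.tr_sub hw hΩ hs0 hs1, Real.norm_eq_abs]
  refine (hC _ hsub).trans_eq ?_
  rw [hsub.sqrt_normtSq hΩ hs0 hs1, Function.comp_apply]
  congr 2
  refine eLpNorm_congr_ae ((hV.grad_sub hw hΩ hs0 hs1).trans ?_)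
  exact (T.grad_ae_eq hΩ hs0 hs1).sub (EventuallyEq.refl _ _)

/-- The boundary value is unique, by the density of `C_c^∞(Ω × ℝ)` in the energy space. -/
theorem IsNormalTrace.eq {N N' : traceDual Ω s} (h : IsNormalTrace Ω s y N)
    (h' : IsNormalTrace Ω s y N') (hΩ : IsOpen Ω) (hs0 : 0 < s) (hs1 : s < 1) : N = N' := by
  refine Subtype.ext (LinearMap.ext fun v => ?_)
  obtain ⟨w, hw, rfl⟩ := exists_tr_eq v hΩ hs0 hs1
  obtain ⟨φ, hφ, hA⟩ := hw.exists_isCc_approx hΩ hs0 hs1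
  refine tendsto_nhds_unique (tendsto_traceDual N hw hΩ hs0 hs1 hA)
    ((tendsto_traceDual N' hw hΩ hs0 hs1 hA).congr fun n => ?_)
  exact neg_injective ((h' _ (hφ n)).symm.trans (h _ (hφ n)))

theorem existsUnique_isNormalTrace (hd : 1 ≤ d) (hΩ : IsOpen Ω) (hΩb : Bornology.IsBounded Ω)
    (hs0 : 0 < s) (hs1 : s < 1) (hy : MemYdiv Ω s y) : ∃! N, IsNormalTrace Ω s y N := by
  obtain ⟨N, hN⟩ := exists_green hd hΩ hΩb hs0 hs1 hy
  have hN' := isNormalTrace_of_green hΩ hs0 hs1 hN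
  exact ⟨N, hN', fun N' h' => h'.eq hN' hΩ hs0 hs1⟩

/-- The Green formula on the whole energy space. -/
theorem MemV.green (hw : MemV Ω s w) (hd : 1 ≤ d) (hΩ : IsOpen Ω) (hΩb : Bornology.IsBounded Ω)
    (hs0 : 0 < s) (hs1 : s < 1) (hy : MemYdiv Ω s y) :
    (∫ z in halfCyl Ω, ⟪y z, grad Ω w z⟫) + ∫ z in halfCyl Ω, w z * divXT Ω y z =
      - (normalTrace Ω s y).1 (tr Ω s w) := by
  obtain ⟨N, hN⟩ := exists_green hd hΩ hΩb hs0 hs1 hy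
  have hN' := isNormalTrace_of_green hΩ hs0 hs1 hN
  have hex : ∃ N, IsNormalTrace Ω s y N := ⟨N, hN'⟩
  have e : normalTrace Ω s y = N := by
    rw [normalTrace, dif_pos hex]
    exact hex.choose_spec.eq hN' hΩ hs0 hs1
  rw [← greenPairing_eq_add hy hΩ hw.1 (hw.memLp_grad hΩ hs0 hs1), e, hN w hw]

/-! ### The error identity -/

theorem normtSq_eq_integral (hΩ : IsOpen Ω) (s : ℝ) (F : E d × ℝ → Vec d) :
    normtSq Ω s F = ∫ z, ‖F z‖ ^ 2 ∂(wMeas Ω (1 - 2 * s)) :=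
  (integral_wMeas hΩ _ _).symm

theorem traceDual_add_apply (G G' : traceDual Ω s) (v : traceSpace Ω s) :
    (G + G').1 v = G.1 v + G'.1 v := by
  rw [Submodule.coe_add, LinearMap.add_apply]

theorem integral_norm_sub_sub_sq {α H : Type*} [MeasurableSpace α] {μ : Measure α}
    [NormedAddCommGroup H] [InnerProductSpace ℝ H] {Y F G : α → H} (hY : MemLp Y 2 μ)
    (hF : MemLp F 2 μ) (hG : MemLp G 2 μ) :
    ∫ z, ‖G z - (Y z - F z)‖ ^ 2 ∂μ =
      (∫ z, ‖G z‖ ^ 2 ∂μ) - 2 * ((∫ z, ⟪Y z, G z⟫ ∂μ) - ∫ z, ⟪F z, G z⟫ ∂μ) +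
        ∫ z, ‖Y z - F z‖ ^ 2 ∂μ := by
  have i1 : Integrable (fun z => ‖G z‖ ^ 2) μ := (memLp_two_iff_integrable_sq_norm hG.1).1 hG
  have i2 : Integrable (fun z => ‖Y z - F z‖ ^ 2) μ :=
    (memLp_two_iff_integrable_sq_norm (hY.sub hF).1).1 (hY.sub hF)
  have i3 := integrable_inner_of_memLp hY hG
  have i4 := integrable_inner_of_memLp hF hG
  have i5 : Integrable (fun z => 2 * (⟪Y z, G z⟫ - ⟪F z, G z⟫)) μ := (i3.sub i4).const_mul 2
  have i6 : Integrable (fun z => ‖G z‖ ^ 2 - 2 * (⟪Y z, G z⟫ - ⟪F z, G z⟫)) μ := i1.sub i5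
  rw [← integral_sub i3 i4, ← integral_const_mul, ← integral_sub i1 i5, ← integral_add i6 i2]
  congr 1
  ext z
  rw [norm_sub_sq_real, real_inner_comm, inner_sub_left]

theorem normtSq_smul_sub_flux (hΩ : IsOpen Ω) (s : ℝ) (w : E d × ℝ → ℝ) (y : E d × ℝ → Vec d) :
    normtSq Ω s (fun z => z.2 ^ (2 * s - 1) • (y z - flux Ω s w z)) =
      ∫ z, ‖z.2 ^ (2 * s - 1) • y z - grad Ω w z‖ ^ 2 ∂(wMeas Ω (1 - 2 * s)) := by
  rw [normtSq_eq_integral hΩ]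
  refine integral_congr_ae (ae_wMeas_of_forall hΩ _ fun z hz => ?_)
  have hz : 0 < z.2 := hz.2
  simp only
  rw [smul_sub, flux, smul_smul, ← Real.rpow_add hz,
    show 2 * s - 1 + (1 - 2 * s) = 0 by ring, Real.rpow_zero, one_smul]

theorem normtSq_grad_sub (hΩ : IsOpen Ω) (hs0 : 0 < s) (hs1 : s < 1) (hw : MemV Ω s w)
    (hw' : MemV Ω s w') (Y : E d × ℝ → Vec d) :
    normtSq Ω s (fun z => grad Ω w' z - Y z) =
      ∫ z, ‖grad Ω (w' - w) z - (Y z - grad Ω w z)‖ ^ 2 ∂(wMeas Ω (1 - 2 * s)) := by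
  rw [normtSq_eq_integral hΩ]
  refine integral_congr_ae ((hw'.grad_sub hw hΩ hs0 hs1).mono fun z hz => ?_)
  simp only [hz, Pi.sub_apply]
  rw [sub_sub_sub_cancel_right]

theorem IsWeakSolution.integral_eq {g : traceDual Ω s} (hw : IsWeakSolution Ω s g w)
    (hΩ : IsOpen Ω) (h : MemV Ω s w') :
    ∫ z, ⟪grad Ω w z, grad Ω w' z⟫ ∂(wMeas Ω (1 - 2 * s)) = g.1 (tr Ω s w') := by
  rw [integral_wMeas hΩ]
  exact sub_eq_zero.1 (hw.2 _ h)

theorem error_identity (hd : 1 ≤ d) (hΩ : IsOpen Ω) (hΩb : Bornology.IsBounded Ω)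
    (hs0 : 0 < s) (hs1 : s < 1) {g : traceDual Ω s} (hw : IsWeakSolution Ω s g w)
    (hw' : MemV Ω s w') (hy : MemYdiv Ω s y) :
    normtSq Ω s (grad Ω (w' - w)) +
        normtSq Ω s (fun z => z.2 ^ (2 * s - 1) • (y z - flux Ω s w z)) =
      normtSq Ω s (fun z => grad Ω w' z - z.2 ^ (2 * s - 1) • y z)
        - 2 * (∫ z in halfCyl Ω, (w' - w) z * divXT Ω y z)
        - 2 * (g.1 (tr Ω s (w' - w)) + (normalTrace Ω s y).1 (tr Ω s (w' - w))) := by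
  have he : MemV Ω s (w' - w) := hw'.sub hw.1 hΩ hs0 hs1
  have h2 := he.green hd hΩ hΩb hs0 hs1 hy
  rw [setIntegral_inner_eq hΩ s] at h2
  rw [normtSq_smul_sub_flux hΩ, normtSq_grad_sub hΩ hs0 hs1 hw.1 hw',
    integral_norm_sub_sub_sq (hy.memLp_smul hΩ) (hw.1.memLp_grad hΩ hs0 hs1)
      (he.memLp_grad hΩ hs0 hs1), hw.integral_eq hΩ he, normtSq_eq_integral hΩ]
  linarith

end Green

end StingaTorrea

open StingaTorrea in
theorem theorem1 {d : ℕ} (hd : 1 ≤ d) (Ω : Set (E d)) (hΩo : IsOpen Ω)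
    (hΩb : Bornology.IsBounded Ω) (s : ℝ) (hs0 : 0 < s) (hs1 : s < 1)
    (g : traceDual Ω s) (w : E d × ℝ → ℝ) (hw : IsWeakSolution Ω s g w)
    (w' : E d × ℝ → ℝ) (hw' : MemV Ω s w')
    (y : E d × ℝ → Vec d) (hy : MemYdiv Ω s y) :
    -- gradients and traces of elements of the energy space are well defined
    (∀ v, MemV Ω s v → HasWeakGrad Ω v (grad Ω v) ∧
      MemLp (grad Ω v) 2 (wMeas Ω (1 - 2 * s)) ∧
      HasTrace Ω s v (tr Ω s v : Lp ℝ 2 (volume.restrict Ω))) ∧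
    -- so is the boundary value of the last component of `y`
    (∃! N, IsNormalTrace Ω s y N) ∧
    IntegrableOn (fun z => (w' - w) z * divXT Ω y z) (halfCyl Ω) ∧
    -- the error identity
    normtSq Ω s (grad Ω (w' - w)) +
        normtSq Ω s (fun z => z.2 ^ (2 * s - 1) • (y z - flux Ω s w z)) =
      normtSq Ω s (fun z => grad Ω w' z - z.2 ^ (2 * s - 1) • y z)
        - 2 * (∫ z in halfCyl Ω, (w' - w) z * divXT Ω y z)
        - 2 * (g + normalTrace Ω s y).1 (tr Ω s (w' - w)) ∧
    -- the same with integrals over `Ω` when `g` and the boundary value are functions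
    (∀ g₀ h : E d → ℝ, IsGivenBy g g₀ → IsGivenBy (normalTrace Ω s y) h →
      IntegrableOn (fun x =>
        (tr Ω s (w' - w) : Lp ℝ 2 (volume.restrict Ω)) x * (g₀ x + h x)) Ω ∧
      normtSq Ω s (grad Ω (w' - w)) +
          normtSq Ω s (fun z => z.2 ^ (2 * s - 1) • (y z - flux Ω s w z)) =
        normtSq Ω s (fun z => grad Ω w' z - z.2 ^ (2 * s - 1) • y z)
          - 2 * (∫ z in halfCyl Ω, (w' - w) z * divXT Ω y z)
          - 2 * ∫ x in Ω,
              (tr Ω s (w' - w) : Lp ℝ 2 (volume.restrict Ω)) x * (g₀ x + h x)) := by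
  have key := error_identity hd hΩo hΩb hs0 hs1 hw hw' hy
  have key' := key
  rw [← traceDual_add_apply g (normalTrace Ω s y) (tr Ω s (w' - w))] at key'
  refine ⟨fun v hv => ⟨hv.hasWeakGrad hΩo hs0 hs1, hv.memLp_grad hΩo hs0 hs1,
    hv.hasTrace_tr hΩo hs0 hs1⟩, existsUnique_isNormalTrace hd hΩo hΩb hs0 hs1 hy,
    integrableOn_mul_divXT hy hΩo (hw'.sub hw.1 hΩo hs0 hs1).1, key', fun g₀ h hg hh => ?_⟩
  obtain ⟨i1, j1⟩ := hg (tr Ω s (w' - w))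
  obtain ⟨i2, j2⟩ := hh (tr Ω s (w' - w))
  rw [j1, j2, ← integral_add i1 i2] at key
  simp_rw [← mul_add] at key
  refine ⟨?_, key⟩
  simp_rw [mul_add]
  exact i1.add i2
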